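/- Let $\mathcal H$ be a real Hilbert space with scalar product $\langle\cdot,\cdot\rangle$ and norm $\|\cdot\|$, let $f,g\colon\mathcal H\to\left]-\infty,+\infty\right]$, and write $\operatorname{dom}h=\{x : h(x)<+\infty\}$. Assume the following. **H1.** $f$ and $g$ are proper, convex and lower semicontinuous, and $\operatorname{dom} g\subset\operatorname{dom} f$. **H2.** $f$ is Gâteaux differentiable on $\operatorname{dom} g$ (for each $x\in\operatorname{dom}g$ there is a vector $\nabla f(x)\in\mathcal H$ with $\lim_{t\to0}(f(x+td)-f(x))/t=\langle d,\nabla f(x)\rangle$ for every $d\in\mathcal H$), and $\nabla f$ is uniformly continuous on every weakly compact subset of $\operatorname{dom} g$. **H3.** $(\langle\cdot,\cdot\rangle_k)_{k\in\mathbb N}$ are scalar products on $\mathcal H$ with induced norms $\|\cdot\|_k$ and associated positive operators $W_k$, i.e. $\langle x,y\rangle_k=\langle x,W_ky\rangle$, and there are $0<\nu\le\mu<+\infty$ with $\nu\|x\|^2\le\|x\|_k^2\le\mu\|x\|^2$ for all $k\in\mathbb N$ and $x\in\mathcal H$. Assume moreover that at least one of the following holds. **H4.** There is a summable sequence $(\eta_k)$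 in $[0,+\infty[$ with $\|x\|_{k+1}^2\le(1+\eta_k)\|x\|_k^2$ for all $k\in\mathbb N$ and $x\in\mathcal H$. **H5.** $\sum_{k\in\mathbb N}(\mu_k-\nu_k)<+\infty$, where $\mu_k=\sup_{\|x\|=1}\langle x,W_kx\rangle$ and $\nu_k=\inf_{\|x\|=1}\langle x,W_kx\rangle$. Let $\nabla^kf$ be the Gâteaux gradient of $f$ with respect to $\langle\cdot,\cdot\rangle_k$ and, for $h$ proper, convex and lower semicontinuous, let $\mathrm{prox}^k_h(x)$ be the unique minimizer over $y\in\mathcal H$ of $h(y)+\tfrac12\|y-x\|_k^2$. For $x\in\operatorname{dom}g$ and $\gamma>0$ set $$J_k(x,\gamma)=\mathrm{prox}^k_{\gamma g}\big(x-\gamma\nabla^kf(x)\big).$$ Let $x_0\in\operatorname{dom}g$ and, for every $k\in\mathbb N$, let $x_{k+1}=J_k(x_k,\gamma_k)$ (the variable metric forward–backward splitting algorithm without relaxation, $\lambda_k\equiv1$). Let $\delta,\theta\in\left]0,1\right[$ and $\bar\gamma>0$, and suppose that the stepsizes $\gamma_k$ are all chosen by one and the same of the following two line search rules: for every $k$,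 $\gamma_k$ is the largest element $\gamma$ of $\{\bar\gamma\theta^i : i\in\mathbb N\}$ such that, with $z=J_k(x_k,\gamma)$, * (LS1) $f(z)-f(x_k)-\langle z-x_k,\nabla f(x_k)\rangle\le\frac{\delta}{\gamma}\|z-x_k\|_k^2$; or * (LS3) $\|\nabla^kf(z)-\nabla^kf(x_k)\|_k\le\frac{\delta}{\gamma}\|z-x_k\|_k$. Let $S_*=\operatorname{argmin}_{\mathcal H}(f+g)$. Then the following hold. 1. $\big((f+g)(x_k)\big)_{k}$ is decreasing (i.e. nonincreasing) and $(f+g)(x_k)\to\inf_{\mathcal H}(f+g)$ in $[-\infty,+\infty]$. 2. If $\inf_{\mathcal H}(f+g)>-\infty$, then $\sum_{k\in\mathbb N}\|x_{k+1}-x_k\|^2<+\infty$. 3. If $S_*\neq\varnothing$, then $(x_k)$ converges weakly to a point of $S_*$; if in addition $\inf_k\gamma_k>0$, then $(f+g)(x_k)-\inf_{\mathcal H}(f+g)=o(1/k)$ as $k\to\infty$. 4. If $S_*=\varnothing$, then $\|x_k\|\to+\infty$. -/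

import Mathlib

open Set Filter Topology Asymptotics

noncomputable section

namespace VMFBS

section Basic

variable {H : Type*} [NormedAddCommGroup H] [InnerProductSpace ℝ H]

/-- The domain of an extended-real-valued function. -/
def dom (h : H → EReal) : Set H := {x | h x < ⊤}

/-- The set of global minimizers of `h`. -/
def argminSet (h : H → EReal) : Set H := {x | h x = ⨅ z, h z}

/-- Proper convex lower semicontinuous functions with values in `]-∞, +∞]`. -/
structure IsGammaZero (h : H → EReal) : Prop where
  ne_bot : ∀ x, h x ≠ ⊥
  dom_nonempty : (dom h).Nonempty
  convex : ∀ (x y : H) (a b : ℝ), 0 < a → 0 < b → a + b = 1 →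
    h (a • x + b • y) ≤ (a : EReal) * h x + (b : EReal) * h y
  lsc : LowerSemicontinuous h

/-- `u` is the Gâteaux gradient of `h` at `x ∈ dom h` in the scalar product `B`:
for every direction `d`, `(h (x + t d) - h x) / t` tends to `B d u` as `t → 0`, `t ≠ 0`.
The quotient is taken in the extended reals, since `h (x + t d)` may be `+∞`. -/
def HasGateauxGradient (B : H → H → ℝ) (h : H → EReal) (x u : H) : Prop :=
  x ∈ dom h ∧ ∀ d : H,
    Tendsto (fun t : ℝ => (h (x + t • d) - h x) / (t : EReal)) (𝓝[≠] 0) (𝓝 (B d u : EReal))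

/-- Gâteaux differentiability of `h` at `x`. -/
def GateauxDifferentiableAt (h : H → EReal) (x : H) : Prop :=
  ∃ u, HasGateauxGradient (inner ℝ) h x u

/-- The gradient of `h` at `x` in the scalar product `B` (meaningful where it exists). -/
def grad (B : H → H → ℝ) (h : H → EReal) (x : H) : H :=
  Classical.epsilon (HasGateauxGradient B h x)

/-- The norm induced by the scalar product `B`. -/
def normOf (B : H → H → ℝ) (x : H) : ℝ := √(B x x)

/-- The proximity operator of `h` in the metric `B`: the minimizer of
`y ↦ h y + (1/2) ‖y - x‖_B²`. -/
def prox (B : H → H → ℝ) (h : H → EReal) (x : H) : H :=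
  Classical.epsilon fun p =>
    p ∈ argminSet fun y => h y + ((1 / 2 * normOf B (y - x) ^ 2 : ℝ) : EReal)

/-- The forward-backward step `x + λ (prox_{γ g} (x - γ ∇f(x)) - x)` in the metric `B`. -/
def fbStep (B : H → H → ℝ) (f g : H → EReal) (x : H) (γ lam : ℝ) : H :=
  x + lam • (prox B (fun y => (γ : EReal) * g y) (x - γ • grad B f x) - x)

/-- The scalar product given by an inner product structure on the vector space `H`
(not related to the ambient one), as a function. -/
def scal (c : InnerProductSpace.Core ℝ H) : H → H → ℝ := c.inner

/-- Hypothesis **H1**. -/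
structure H1 (f g : H → EReal) : Prop where
  f_mem : IsGammaZero f
  g_mem : IsGammaZero g
  dom_subset : dom g ⊆ dom f

/-- Hypothesis **H2**: `f` is Gâteaux differentiable on `dom g`, and `∇f` is uniformly
continuous (for the norm of `H`) on every weakly compact subset of `dom g`. -/
structure H2 (f g : H → EReal) : Prop where
  differentiable : ∀ x ∈ dom g, GateauxDifferentiableAt f x
  uniformContinuousOn : ∀ K ⊆ dom g, IsCompact (toWeakSpace ℝ H '' K) →
    UniformContinuousOn (grad (inner ℝ) f) K

/-- Hypothesis **H3**: `S k` are scalar products on `H`, with associated operators `W k`, whose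
norms are equivalent to the norm of `H`, uniformly in `k`. -/
structure H3 (S : ℕ → InnerProductSpace.Core ℝ H) (W : ℕ → H → H) : Prop where
  associated : ∀ k x y, scal (S k) x y = inner ℝ x (W k y)
  bounds : ∃ ν μ : ℝ, 0 < ν ∧ ν ≤ μ ∧ ∀ (k : ℕ) (x : H),
    ν * ‖x‖ ^ 2 ≤ normOf (scal (S k)) x ^ 2 ∧ normOf (scal (S k)) x ^ 2 ≤ μ * ‖x‖ ^ 2

/-- Hypothesis **H4**. -/
def H4 (S : ℕ → InnerProductSpace.Core ℝ H) : Prop :=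
  ∃ η : ℕ → ℝ, (∀ k, 0 ≤ η k) ∧ Summable η ∧ ∀ (k : ℕ) (x : H),
    normOf (scal (S (k + 1))) x ^ 2 ≤ (1 + η k) * normOf (scal (S k)) x ^ 2

/-- The largest spectral value `sup_{‖x‖ = 1} ⟨x, W x⟩` of `W`. -/
def maxEigenvalue (W : H → H) : ℝ := ⨆ x : Metric.sphere (0 : H) 1, inner ℝ (x : H) (W x)

/-- The smallest spectral value `inf_{‖x‖ = 1} ⟨x, W x⟩` of `W`. -/
def minEigenvalue (W : H → H) : ℝ := ⨅ x : Metric.sphere (0 : H) 1, inner ℝ (x : H) (W x)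

/-- Hypothesis **H5**. -/
def H5 (W : ℕ → H → H) : Prop :=
  Summable fun k => maxEigenvalue (W k) - minEigenvalue (W k)

/-- `x`, `y` are generated by the variable metric forward-backward splitting algorithm with
stepsizes `γ` and relaxation parameters `lam`. -/
structure IsVMFBS (S : ℕ → InnerProductSpace.Core ℝ H) (f g : H → EReal)
    (γ lam : ℕ → ℝ) (x y : ℕ → H) : Prop where
  init : x 0 ∈ dom g
  stepsize_pos : ∀ k, 0 < γ k
  relaxation_mem : ∀ k, lam k ∈ Ioc (0 : ℝ) 1
  backward : ∀ k, y k = prox (scal (S k)) (fun z => (γ k : EReal) * g z)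
    (x k - γ k • grad (scal (S k)) f (x k))
  relax : ∀ k, x (k + 1) = x k + lam k • (y k - x k)

/-- The line search rule **LS1**, with parameters `δ`, `θ`, `γbar`. -/
structure LS1 (S : ℕ → InnerProductSpace.Core ℝ H) (f g : H → EReal)
    (δ θ γbar : ℝ) (γ lam : ℕ → ℝ) (x : ℕ → H) : Prop where
  relaxation_pos : 0 < ⨅ k, lam k
  relaxation_le : ∀ k, lam k ≤ 1
  stepsize : ∀ k, IsGreatest {c : ℝ | 0 < c ∧ (∃ i : ℕ, c = γbar * θ ^ i) ∧
    f (fbStep (scal (S k)) f g (x k) c (lam k)) - f (x k)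
        - ((inner ℝ (fbStep (scal (S k)) f g (x k) c (lam k) - x k)
            (grad (inner ℝ) f (x k)) : ℝ) : EReal)
      ≤ ((δ / (c * lam k) *
          normOf (scal (S k)) (fbStep (scal (S k)) f g (x k) c (lam k) - x k) ^ 2 : ℝ) : EReal)}
    (γ k)

/-- The line search rule **LS3**, with parameters `δ`, `θ`, `γbar`. -/
structure LS3 (S : ℕ → InnerProductSpace.Core ℝ H) (f g : H → EReal)
    (δ θ γbar : ℝ) (γ lam : ℕ → ℝ) (x : ℕ → H) : Prop where
  relaxation_pos : 0 < ⨅ k, lam k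
  relaxation_le : ∀ k, lam k ≤ 1
  stepsize : ∀ k, IsGreatest {c : ℝ | 0 < c ∧ (∃ i : ℕ, c = γbar * θ ^ i) ∧
    normOf (scal (S k)) (grad (scal (S k)) f (fbStep (scal (S k)) f g (x k) c (lam k))
        - grad (scal (S k)) f (x k))
      ≤ δ / (c * lam k) *
          normOf (scal (S k)) (fbStep (scal (S k)) f g (x k) c (lam k) - x k)}
    (γ k)

end Basic

end VMFBS

end

open VMFBS

namespace VMFBS

/-! ### Real sequences -/

section Sequences

/-! On `D = dom g` write `F = f + g`, real-valued there, and express each proximal step by its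
variational inequality. Testing it at `x k` and using the line search gives descent: `F (x k)` drops
by at least `(1 - δ) / γ k` times the squared displacement in the current metric. Testing it at any
`y ∈ D` gives a Fejér inequality: the squared distance to `y` changes by at most the squared
displacement minus `2 * γ k * (F (x (k + 1)) - F y)`. Under H4 or H5, suitable operators `V k`,
decreasing and uniformly elliptic, carry this inequality from one metric to the next.

The crux is `exists_value_lt`: the values approach the infimum although the stepsizes may tend to 0.
If `F (x k) ≥ F y + ε` for all `k`, the Fejér inequality makes `γ` summable; with descent, the path
then has finite length and converges in norm to some `a ∈ D`. Since `γ k → 0`, eventually the larger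
stepsize `γ k / θ` was rejected. The rejected points also tend to `a`, and rejection bounds
displacement over stepsize by a gradient difference, which vanishes by continuity of `∇f` at `a`. So
the optimality residual vanishes, contradicting `ε`.

Since sublevel sets are weakly closed, every weak cluster point is a minimizer. Without minimizers,
no subsequence is bounded; with one, the iterates are bounded and an Opial argument in the norms of
`V k` makes the cluster point unique. If the stepsizes are bounded below, the value gaps are
summable and decreasing, hence `o(1/k)`. -/

theorem tendsto_nat_mul_of_antitone_of_summable {a : ℕ → ℝ} (hanti : Antitone a)
    (hsum : Summable a) : Tendsto (fun n : ℕ => (n : ℝ) * a n) atTop (𝓝 0) := by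
  have hnonneg : ∀ n, 0 ≤ a n := fun n =>
    le_of_tendsto hsum.tendsto_atTop_zero ((eventually_ge_atTop n).mono fun m hm => hanti hm)
  have hs := hsum.tendsto_sum_tsum_nat
  have hhalf : Tendsto (fun n : ℕ => n / 2) atTop atTop :=
    Nat.tendsto_div_const_atTop (by norm_num)
  have hlim := ((hs.sub (hs.comp hhalf)).const_mul 2)
  rw [sub_self, mul_zero] at hlim
  refine squeeze_zero (fun n => mul_nonneg n.cast_nonneg (hnonneg n)) (fun n => ?_) hlim
  have hle : n / 2 ≤ n := Nat.div_le_self n 2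
  -- Every term of the block from `n / 2` to `n` dominates `a n`, and the block is a difference of
  -- partial sums with the same limit.
  have hIco : ((n - n / 2 : ℕ) : ℝ) * a n ≤ ∑ j ∈ Finset.Ico (n / 2) n, a j := by
    have := Finset.card_nsmul_le_sum (Finset.Ico (n / 2) n) a (a n)
      (fun j hj => hanti (Finset.mem_Ico.1 hj).2.le)
    simpa using this
  have hn : (n : ℝ) ≤ 2 * ((n - n / 2 : ℕ) : ℝ) := by
    have : n ≤ 2 * (n - n / 2) := by omega
    exact_mod_cast this
  rw [Finset.sum_Ico_eq_sub _ hle] at hIco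
  have := mul_le_mul_of_nonneg_right hn (hnonneg n)
  simp only [Function.comp_apply]
  linarith

/-- Summable perturbations of a decreasing nonnegative sequence. -/
theorem quasiFejer_real {u v e : ℕ → ℝ} (hu : ∀ k, 0 ≤ u k) (hv : ∀ k, 0 ≤ v k)
    (he : Summable e) (he0 : ∀ k, 0 ≤ e k) (h : ∀ k, u (k + 1) + v k ≤ u k + e k) :
    (∃ l, Tendsto u atTop (𝓝 l)) ∧ Summable v := by
  have hE : ∀ n, ∑ k ∈ Finset.range n, e k ≤ ∑' k, e k := fun n =>
    he.sum_le_tsum _ (fun k _ => he0 k)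
  constructor
  · have hanti : Antitone fun n => u n - ∑ k ∈ Finset.range n, e k := by
      refine antitone_nat_of_succ_le fun n => ?_
      rw [Finset.sum_range_succ]
      linarith [h n, hv n]
    have hbdd : BddBelow (range fun n => u n - ∑ k ∈ Finset.range n, e k) :=
      ⟨-∑' k, e k, by rintro _ ⟨n, rfl⟩; dsimp only; linarith [hu n, hE n]⟩
    refine ⟨_, ((tendsto_atTop_ciInf hanti hbdd).add he.tendsto_sum_tsum_nat).congr fun n => ?_⟩
    ring
  · refine summable_of_sum_range_le (c := u 0 + ∑' k, e k) hv fun n => ?_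
    have : u n + ∑ k ∈ Finset.range n, v k ≤ u 0 + ∑ k ∈ Finset.range n, e k := by
      induction n with
      | zero => simp
      | succ n ih =>
        rw [Finset.sum_range_succ, Finset.sum_range_succ]
        linarith [h n]
    linarith [hu n, hE n]

theorem prod_one_add_le_exp_tsum {η : ℕ → ℝ} (h0 : ∀ k, 0 ≤ η k) (hη : Summable η) (n : ℕ) :
    ∏ j ∈ Finset.range n, (1 + η j) ≤ Real.exp (∑' j, η j) := by
  calc ∏ j ∈ Finset.range n, (1 + η j) ≤ ∏ j ∈ Finset.range n, Real.exp (η j) :=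
        Finset.prod_le_prod (fun j _ => by linarith [h0 j])
          fun j _ => by linarith [Real.add_one_le_exp (η j)]
    _ = Real.exp (∑ j ∈ Finset.range n, η j) := (Real.exp_sum _ _).symm
    _ ≤ _ := Real.exp_le_exp.2 (hη.sum_le_tsum _ fun k _ => h0 k)

theorem one_le_prod_one_add {η : ℕ → ℝ} (h0 : ∀ k, 0 ≤ η k) (n : ℕ) :
    1 ≤ ∏ j ∈ Finset.range n, (1 + η j) := by
  simpa using Finset.prod_le_prod (s := Finset.range n) (f := fun _ => (1 : ℝ))
    (fun _ _ => zero_le_one) fun j _ => by linarith [h0 j]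

end Sequences

/-! ### Weak compactness and weak limits -/

section WeakTopology

variable {H : Type*} [NormedAddCommGroup H] [InnerProductSpace ℝ H] [CompleteSpace H]

/-- Banach–Alaoglu transported by the Riesz isomorphism. Ultrafilters replace subsequences, so no
separability enters. -/
theorem exists_tendsto_inner_of_ultrafilter {ι : Type*} (U : Ultrafilter ι) {u : ι → H} {R : ℝ}
    (hR : ∀ᶠ i in (U : Filter ι), ‖u i‖ ≤ R) :
    ∃ a : H, ∀ v, Tendsto (fun i => inner ℝ (u i) v) U (𝓝 (inner ℝ a v)) := by
  let w : ι → WeakDual ℝ H := fun i => StrongDual.toWeakDual (InnerProductSpace.toDual ℝ H (u i))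
  have hK := WeakDual.isCompact_closedBall (𝕜 := ℝ) (E := H) 0 R
  have hmem : (U.map w : Filter (WeakDual ℝ H)) ≤
      𝓟 (WeakDual.toStrongDual ⁻¹' Metric.closedBall (0 : StrongDual ℝ H) R) := by
    rw [le_principal_iff]
    change ∀ᶠ i in (U : Filter ι), _
    filter_upwards [hR] with i hi
    simpa [w] using hi
  obtain ⟨b, -, hb⟩ := hK.ultrafilter_le_nhds (U.map w) hmem
  have hb' : Tendsto w U (𝓝 b) := hb
  refine ⟨(InnerProductSpace.toDual ℝ H).symm (WeakDual.toStrongDual b), fun v => ?_⟩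
  have := ((WeakDual.eval_continuous v).tendsto b).comp hb'
  simpa [w, Function.comp_def] using this

/-- The obtuse-angle inequality at the projection `p` of `a` onto `C` passes to the weak limit and
yields `‖a - p‖² ≤ 0`. -/
theorem mem_of_tendsto_inner {ι : Type*} {l : Filter ι} [l.NeBot] {u : ι → H} {a : H} {C : Set H}
    (hC : Convex ℝ C) (hcl : IsClosed C) (hu : ∀ᶠ i in l, u i ∈ C)
    (ha : ∀ v, Tendsto (fun i => inner ℝ (u i) v) l (𝓝 (inner ℝ a v))) : a ∈ C := by
  obtain ⟨i, hi⟩ := hu.exists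
  obtain ⟨p, hp, hpe⟩ := exists_norm_eq_iInf_of_complete_convex ⟨_, hi⟩ hcl.isComplete hC a
  have hp' := (norm_eq_iInf_iff_real_inner_le_zero hC hp).1 hpe
  have h1 : Tendsto (fun i => inner ℝ (a - p) (u i - p)) l (𝓝 (inner ℝ (a - p) (a - p))) := by
    simp only [inner_sub_right]
    simp_rw [real_inner_comm _ (a - p)]
    exact (ha (a - p)).sub_const _
  have h2 : inner ℝ (a - p) (a - p) ≤ 0 :=
    le_of_tendsto h1 (hu.mono fun i hi => hp' _ hi)
  have h3 : a - p = 0 := inner_self_eq_zero.1 (le_antisymm h2 real_inner_self_nonneg)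
  rwa [sub_eq_zero.1 h3]

theorem tendsto_toWeakSpace_of_tendsto_inner {ι : Type*} {l : Filter ι} {u : ι → H} {a : H}
    (ha : ∀ v, Tendsto (fun i => inner ℝ (u i) v) l (𝓝 (inner ℝ a v))) :
    Tendsto (fun i => toWeakSpace ℝ H (u i)) l (𝓝 (toWeakSpace ℝ H a)) := by
  have hinj : Function.Injective (topDualPairing ℝ H).flip := by
    intro b c hbc
    refine ext_inner_left ℝ fun v => ?_
    have := congrArg (fun φ => φ (InnerProductSpace.toDual ℝ H v)) hbc
    simpa using this
  refine (WeakBilin.tendsto_iff_forall_eval_tendsto (B := (topDualPairing ℝ H).flip) hinj).2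
    fun φ => ?_
  have := ha ((InnerProductSpace.toDual ℝ H).symm φ)
  simp_rw [real_inner_comm ((InnerProductSpace.toDual ℝ H).symm φ),
    InnerProductSpace.toDual_symm_apply] at this
  exact this

end WeakTopology

/-! ### Positive operators and the metrics they define -/

section MetricOperators

variable {H : Type*} [NormedAddCommGroup H] [InnerProductSpace ℝ H]

/-- Cauchy–Schwarz by the discriminant. Only semidefiniteness is required, so it also serves for the
differences `V n - V m`. -/
theorem inner_apply_sq_le {T : H →L[ℝ] H}
    (hsym : ∀ x y, inner ℝ (T x) y = inner ℝ x (T y)) (hpos : ∀ x, 0 ≤ inner ℝ x (T x))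
    (x y : H) : inner ℝ x (T y) ^ 2 ≤ inner ℝ x (T x) * inner ℝ y (T y) := by
  have h := discrim_le_zero (a := inner ℝ y (T y)) (b := 2 * inner ℝ x (T y))
    (c := inner ℝ x (T x)) fun t => by
      have := hpos (x + t • y)
      simp only [map_add, map_smul, inner_add_left, inner_add_right, inner_smul_left,
        inner_smul_right] at this
      have h1 : inner ℝ y (T x) = inner ℝ x (T y) := by rw [real_inner_comm, hsym]
      simp only [h1, conj_trivial] at this
      nlinarith
  rw [discrim] at h
  nlinarith

theorem norm_apply_sq_le {T : H →L[ℝ] H} {M : ℝ}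
    (hsym : ∀ x y, inner ℝ (T x) y = inner ℝ x (T y)) (hpos : ∀ x, 0 ≤ inner ℝ x (T x))
    (hM : ∀ x, inner ℝ x (T x) ≤ M * ‖x‖ ^ 2) (x : H) :
    ‖T x‖ ^ 2 ≤ M * inner ℝ x (T x) := by
  have h := inner_apply_sq_le hsym hpos (T x) x
  rw [real_inner_self_eq_norm_sq] at h
  have h2 := mul_le_mul_of_nonneg_right (hM (T x)) (hpos x)
  by_cases h0 : T x = 0
  · simp [h0]
  · have : 0 < ‖T x‖ ^ 2 := by positivity
    refine le_of_mul_le_mul_left ?_ this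
    nlinarith

/-- A decreasing sequence of positive operators converges strongly. -/
theorem exists_tendsto_apply_of_antitone [CompleteSpace H] {V : ℕ → H →L[ℝ] H}
    (hsym : ∀ k x y, inner ℝ (V k x) y = inner ℝ x (V k y))
    (hpos : ∀ k x, 0 ≤ inner ℝ x (V k x))
    (hanti : ∀ k x, inner ℝ x (V (k + 1) x) ≤ inner ℝ x (V k x)) (x : H) :
    ∃ y, Tendsto (fun k => V k x) atTop (𝓝 y) := by
  have hanti' : ∀ x, Antitone fun k => inner ℝ x (V k x) := fun x =>
    antitone_nat_of_succ_le fun k => hanti k x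
  have hbdd : BddBelow (range fun k => inner ℝ x (V k x)) :=
    ⟨0, by rintro _ ⟨k, rfl⟩; exact hpos k x⟩
  set L := ⨅ k, inner ℝ x (V k x) with hL
  have hlim : Tendsto (fun k => inner ℝ x (V k x)) atTop (𝓝 L) :=
    tendsto_atTop_ciInf (hanti' x) hbdd
  have hb : Tendsto (fun k => √(‖V 0‖ * (inner ℝ x (V k x) - L))) atTop (𝓝 0) := by
    have := ((hlim.sub_const L).const_mul ‖V 0‖).sqrt
    simpa using this
  refine cauchySeq_tendsto_of_complete (cauchySeq_of_le_tendsto_0' _ (fun n m hnm => ?_) hb)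
  rw [dist_eq_norm, ← _root_.sub_apply]
  refine Real.le_sqrt_of_sq_le ?_
  -- For `n ≤ m` the difference is positive and lies below `V 0`, so convergence of the quadratic
  -- form at `x` controls the norm of the difference applied to `x`.
  refine (norm_apply_sq_le (T := V n - V m) (M := ‖V 0‖) ?_ ?_ ?_ x).trans ?_
  · intro a b
    simp [inner_sub_left, inner_sub_right, hsym]
  · intro a
    simpa [inner_sub_right] using hanti' a hnm
  · intro a
    have h1 : inner ℝ a (V 0 a) ≤ ‖V 0‖ * ‖a‖ ^ 2 := by
      calc inner ℝ a (V 0 a) ≤ ‖a‖ * ‖V 0 a‖ := real_inner_le_norm _ _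
        _ ≤ ‖a‖ * (‖V 0‖ * ‖a‖) := by gcongr; exact (V 0).le_opNorm a
        _ = _ := by ring
    have h2 := hanti' a (Nat.zero_le n)
    simp only [_root_.sub_apply, inner_sub_right]
    linarith [hpos m a]
  · gcongr
    simp only [_root_.sub_apply, inner_sub_right]
    linarith [ciInf_le hbdd m]

/-- `A` is the operator of a scalar product whose squared norm lies between `ν ‖x‖²` and
`μ ‖x‖²`. -/
structure IsMetricOperator (ν μ : ℝ) (A : H →L[ℝ] H) : Prop where
  symm : ∀ x y, inner ℝ (A x) y = inner ℝ x (A y)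
  lower : ∀ x, ν * ‖x‖ ^ 2 ≤ inner ℝ x (A x)
  upper : ∀ x, inner ℝ x (A x) ≤ μ * ‖x‖ ^ 2

namespace IsMetricOperator

variable {ν μ : ℝ} {A : H →L[ℝ] H}

theorem nonneg (hA : IsMetricOperator ν μ A) (hν : 0 < ν) (x : H) : 0 ≤ inner ℝ x (A x) :=
  (by positivity : 0 ≤ ν * ‖x‖ ^ 2).trans (hA.lower x)

theorem inner_le (hA : IsMetricOperator ν μ A) (hν : 0 < ν) (x y : H) :
    inner ℝ x (A y) ≤ √(inner ℝ x (A x)) * √(inner ℝ y (A y)) := by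
  rw [← Real.sqrt_mul (hA.nonneg hν x)]
  exact Real.le_sqrt_of_sq_le (inner_apply_sq_le hA.symm (hA.nonneg hν) x y)

theorem sqrt_lower (hA : IsMetricOperator ν μ A) (hν : 0 < ν) (x : H) :
    √ν * ‖x‖ ≤ √(inner ℝ x (A x)) := by
  refine Real.le_sqrt_of_sq_le ?_
  rw [mul_pow, Real.sq_sqrt hν.le]
  exact hA.lower x

theorem sqrt_upper (hA : IsMetricOperator ν μ A) (hμ : 0 ≤ μ) (x : H) :
    √(inner ℝ x (A x)) ≤ √μ * ‖x‖ := by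
  refine Real.sqrt_le_iff.2 ⟨by positivity, ?_⟩
  rw [mul_pow, Real.sq_sqrt hμ]
  exact hA.upper x

theorem inner_comm (hA : IsMetricOperator ν μ A) (x y : H) :
    inner ℝ x (A y) = inner ℝ y (A x) := by
  rw [← hA.symm, real_inner_comm]

theorem inner_neg_self (x : H) : inner ℝ (-x) (A (-x)) = inner ℝ x (A x) := by simp

theorem inner_sub_self_comm (x y : H) :
    inner ℝ (x - y) (A (x - y)) = inner ℝ (y - x) (A (y - x)) := by
  rw [← inner_neg_self, neg_sub]

theorem inner_add_self (hA : IsMetricOperator ν μ A) (x y : H) :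
    inner ℝ (x + y) (A (x + y)) =
      inner ℝ x (A x) + 2 * inner ℝ x (A y) + inner ℝ y (A y) := by
  simp only [map_add, inner_add_left, inner_add_right]
  rw [hA.inner_comm y x]
  ring

/-- Lax–Milgram; this is what makes gradients exist in the metric of `A`. -/
theorem surjective [CompleteSpace H] (hA : IsMetricOperator ν μ A) (hν : 0 < ν) :
    Function.Surjective A := by
  have hco : IsCoercive ((innerSL ℝ).comp A) :=
    ⟨ν, hν, fun u => by
      have := hA.lower u
      rw [← hA.symm] at this
      simpa [pow_two, mul_assoc] using this⟩
  intro v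
  obtain ⟨u, hu⟩ := hco.continuousLinearEquivOfBilin.surjective v
  refine ⟨u, ext_inner_right ℝ fun w => ?_⟩
  rw [← hu, hco.continuousLinearEquivOfBilin_apply]
  simp

end IsMetricOperator

end MetricOperators

end VMFBS

namespace VMFBS

/-! ### Forward-backward steps: descent and Fejér inequalities -/

section ForwardBackward

variable {H : Type*} [NormedAddCommGroup H] [InnerProductSpace ℝ H]

/-- `p` is the forward-backward step from `u` with forward direction `v` and stepsize `c` in the
metric of `A`, expressed by its variational inequality. -/
structure IsForwardBackwardStep (D : Set H) (ψ : H → ℝ) (A : H →L[ℝ] H) (u v : H) (c : ℝ)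
    (p : H) : Prop where
  mem : p ∈ D
  le : ∀ y ∈ D, ψ p + c⁻¹ * inner ℝ (y - p) (A (u - p)) ≤ ψ y + inner ℝ (y - p) v

/-- The displacement of a forward-backward step is nondecreasing in the stepsize, and its
quotient by the stepsize is nonincreasing. -/
theorem IsForwardBackwardStep.monotone {D : Set H} {ψ : H → ℝ} {A : H →L[ℝ] H} {ν μ : ℝ}
    (hA : IsMetricOperator ν μ A) (hν : 0 < ν) {u v p q : H} {c d : ℝ} (hc : 0 < c) (hcd : c < d)
    (hp : IsForwardBackwardStep D ψ A u v c p) (hq : IsForwardBackwardStep D ψ A u v d q) :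
    √(inner ℝ (u - p) (A (u - p))) ≤ √(inner ℝ (u - q) (A (u - q))) ∧
      √(inner ℝ (u - q) (A (u - q))) / d ≤ √(inner ℝ (u - p) (A (u - p))) / c := by
  have h1 := hp.le q hq.mem
  have h2 := hq.le p hp.mem
  have hd : 0 < d := hc.trans hcd
  have e1 : inner ℝ (q - p) (A (u - p)) =
      inner ℝ (u - p) (A (u - p)) - inner ℝ (u - q) (A (u - p)) := by
    rw [← inner_sub_left]; congr 1; abel
  have e2 : inner ℝ (p - q) (A (u - q)) =
      inner ℝ (u - q) (A (u - q)) - inner ℝ (u - q) (A (u - p)) := by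
    rw [hA.inner_comm (u - q) (u - p), ← inner_sub_left]; congr 1; abel
  have e3 : inner ℝ (p - q) v = -inner ℝ (q - p) v := by rw [← inner_neg_left, neg_sub]
  rw [e1] at h1
  rw [e2, e3] at h2
  have h3 := hA.inner_le hν (u - q) (u - p)
  have sa := Real.sq_sqrt (hA.nonneg hν (u - p))
  have sb := Real.sq_sqrt (hA.nonneg hν (u - q))
  set a := √(inner ℝ (u - p) (A (u - p)))
  set b := √(inner ℝ (u - q) (A (u - q)))
  have ha : 0 ≤ a := Real.sqrt_nonneg _
  have hb : 0 ≤ b := Real.sqrt_nonneg _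
  rw [← sa] at h1
  rw [← sb] at h2
  -- Adding the two variational inequalities, each tested at the other point, cancels `ψ` and `v`;
  -- Cauchy–Schwarz leaves this sign condition on the displacements `a`, `b`, from which both claims
  -- follow.
  have hkey : (a - b) * (a * d - b * c) ≤ 0 := by
    have h4 : c⁻¹ * (a ^ 2 - b * a) + d⁻¹ * (b ^ 2 - b * a) ≤ 0 := by
      have := mul_le_mul_of_nonneg_left h3 (inv_pos.2 hc).le
      have := mul_le_mul_of_nonneg_left h3 (inv_pos.2 hd).le
      linarith
    have h5 : (a - b) * (a * d - b * c) =
        c * d * (c⁻¹ * (a ^ 2 - b * a) + d⁻¹ * (b ^ 2 - b * a)) := by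
      field_simp
      ring
    rw [h5]
    exact mul_nonpos_of_nonneg_of_nonpos (by positivity) h4
  have hab : a ≤ b := by
    by_contra! hlt
    have : b * c ≤ b * d := mul_le_mul_of_nonneg_left hcd.le hb
    have : b * d < a * d := mul_lt_mul_of_pos_right hlt hd
    nlinarith
  refine ⟨hab, ?_⟩
  rw [div_le_div_iff₀ hd hc]
  by_contra! hlt
  rcases hab.eq_or_lt with h | h
  · rw [h] at hlt
    nlinarith
  · nlinarith

/-- A sequence generated by forward-backward steps with backtracked stepsizes, for real-valued
`φ`, `ψ` on a set `D`; `G` is the gradient of `φ`. -/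
structure IsForwardBackwardRun (D : Set H) (φ ψ : H → ℝ) (G : H → H) (A : ℕ → H →L[ℝ] H)
    (ν μ δ θ γbar C : ℝ) (γ : ℕ → ℝ) (x : ℕ → H) : Prop where
  ν_pos : 0 < ν
  μ_nonneg : 0 ≤ μ
  metric : ∀ k, IsMetricOperator ν μ (A k)
  gradient : ∀ u ∈ D, ∀ v ∈ D, φ u + inner ℝ (v - u) (G u) ≤ φ v
  continuousOn : ContinuousOn G D
  convex : ∀ a, Convex ℝ {u ∈ D | φ u + ψ u ≤ a}
  isClosed : ∀ a, IsClosed {u ∈ D | φ u + ψ u ≤ a}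
  δ_lt : δ < 1
  θ_mem : θ ∈ Ioo (0 : ℝ) 1
  init : x 0 ∈ D
  γ_pos : ∀ k, 0 < γ k
  γ_le : ∀ k, γ k ≤ γbar
  step : ∀ k, IsForwardBackwardStep D ψ (A k) (x k) (G (x k)) (γ k) (x (k + 1))
  decrease : ∀ k, φ (x (k + 1)) ≤ φ (x k) + inner ℝ (x (k + 1) - x k) (G (x k)) +
    δ / γ k * inner ℝ (x k - x (k + 1)) (A k (x k - x (k + 1)))
  backtrack : ∀ k, γ k = γbar ∨
    ∃ z, IsForwardBackwardStep D ψ (A k) (x k) (G (x k)) (γ k / θ) z ∧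
      √(inner ℝ (x k - z) (A k (x k - z))) / (γ k / θ) ≤ C * ‖G z - G (x k)‖

/-- Decreasing operators `V k` controlling the metrics `A k`. -/
structure IsMonotoneRescaling (A V : ℕ → H →L[ℝ] H) (c : ℕ → ℝ) (κ c₀ c₁ : ℝ) : Prop where
  κ_pos : 0 < κ
  c₀_pos : 0 < c₀
  symm : ∀ k x y, inner ℝ (V k x) y = inner ℝ x (V k y)
  lower : ∀ k x, κ * ‖x‖ ^ 2 ≤ inner ℝ x (V k x)
  antitone : ∀ k x, inner ℝ x (V (k + 1) x) ≤ inner ℝ x (V k x)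
  le_c : ∀ k, c₀ ≤ c k
  c_le : ∀ k, c k ≤ c₁
  transfer : ∀ k a b r, inner ℝ a (A k a) ≤ inner ℝ b (A k b) + r →
    inner ℝ a (V (k + 1) a) ≤ inner ℝ b (V k b) + c k * r

namespace IsForwardBackwardRun

variable {D : Set H} {φ ψ : H → ℝ} {G : H → H} {A : ℕ → H →L[ℝ] H}
  {ν μ δ θ γbar C : ℝ} {γ : ℕ → ℝ} {x : ℕ → H}

theorem mem (h : IsForwardBackwardRun D φ ψ G A ν μ δ θ γbar C γ x) : ∀ k, x k ∈ D
  | 0 => h.init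
  | k + 1 => (h.step k).mem

theorem displacement_nonneg (h : IsForwardBackwardRun D φ ψ G A ν μ δ θ γbar C γ x) (k : ℕ) :
    0 ≤ inner ℝ (x k - x (k + 1)) (A k (x k - x (k + 1))) :=
  (h.metric k).nonneg h.ν_pos _

theorem descent (h : IsForwardBackwardRun D φ ψ G A ν μ δ θ γbar C γ x) (k : ℕ) :
    φ (x (k + 1)) + ψ (x (k + 1)) +
      (1 - δ) / γ k * inner ℝ (x k - x (k + 1)) (A k (x k - x (k + 1))) ≤ φ (x k) + ψ (x k) := by
  have h1 := (h.step k).le _ (h.mem k)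
  have h2 := h.decrease k
  have h3 : inner ℝ (x (k + 1) - x k) (G (x k)) = -inner ℝ (x k - x (k + 1)) (G (x k)) := by
    rw [← inner_neg_left, neg_sub]
  rw [h3] at h2
  have h4 : (1 - δ) / γ k = (γ k)⁻¹ - δ / γ k := by ring
  rw [h4, sub_mul]
  linarith

theorem antitone (h : IsForwardBackwardRun D φ ψ G A ν μ δ θ γbar C γ x) :
    Antitone fun k => φ (x k) + ψ (x k) := by
  refine antitone_nat_of_succ_le fun k => ?_
  have h1 := h.descent k
  have h2 : 0 ≤ (1 - δ) / γ k * inner ℝ (x k - x (k + 1)) (A k (x k - x (k + 1))) :=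
    mul_nonneg (div_nonneg (by linarith [h.δ_lt]) (h.γ_pos k).le) (h.displacement_nonneg k)
  linarith

theorem summable_displacement_div (h : IsForwardBackwardRun D φ ψ G A ν μ δ θ γbar C γ x) {m : ℝ}
    (hm : ∀ k, m ≤ φ (x k) + ψ (x k)) :
    Summable fun k => inner ℝ (x k - x (k + 1)) (A k (x k - x (k + 1))) / γ k := by
  have hδ : 0 < 1 - δ := by linarith [h.δ_lt]
  refine summable_of_sum_range_le (c := (1 - δ)⁻¹ * (φ (x 0) + ψ (x 0) - m))
    (fun k => div_nonneg (h.displacement_nonneg k) (h.γ_pos k).le) fun n => ?_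
  rw [le_inv_mul_iff₀ hδ]
  have : φ (x n) + ψ (x n) + (1 - δ) * ∑ k ∈ Finset.range n,
      inner ℝ (x k - x (k + 1)) (A k (x k - x (k + 1))) / γ k ≤ φ (x 0) + ψ (x 0) := by
    induction n with
    | zero => simp
    | succ n ih =>
      rw [Finset.sum_range_succ, mul_add]
      have h1 := h.descent n
      have h2 : (1 - δ) * (inner ℝ (x n - x (n + 1)) (A n (x n - x (n + 1))) / γ n) =
        (1 - δ) / γ n * inner ℝ (x n - x (n + 1)) (A n (x n - x (n + 1))) := by ring
      linarith
  linarith [hm n]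

theorem summable_displacement (h : IsForwardBackwardRun D φ ψ G A ν μ δ θ γbar C γ x) {m : ℝ}
    (hm : ∀ k, m ≤ φ (x k) + ψ (x k)) :
    Summable fun k => inner ℝ (x k - x (k + 1)) (A k (x k - x (k + 1))) := by
  refine Summable.of_nonneg_of_le h.displacement_nonneg (fun k => ?_)
    ((h.summable_displacement_div hm).mul_left γbar)
  rw [mul_div_assoc', le_div_iff₀ (h.γ_pos k), mul_comm γbar]
  exact mul_le_mul_of_nonneg_left (h.γ_le k) (h.displacement_nonneg k)

theorem summable_norm_sq (h : IsForwardBackwardRun D φ ψ G A ν μ δ θ γbar C γ x) {m : ℝ}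
    (hm : ∀ k, m ≤ φ (x k) + ψ (x k)) : Summable fun k => ‖x (k + 1) - x k‖ ^ 2 := by
  refine Summable.of_nonneg_of_le (fun k => by positivity) (fun k => ?_)
    ((h.summable_displacement hm).mul_left ν⁻¹)
  rw [le_inv_mul_iff₀ h.ν_pos, norm_sub_rev]
  exact (h.metric k).lower _

/-- The fundamental inequality of a forward-backward step. -/
theorem fejer (h : IsForwardBackwardRun D φ ψ G A ν μ δ θ γbar C γ x) (k : ℕ) {y : H}
    (hy : y ∈ D) :
    inner ℝ (x (k + 1) - y) (A k (x (k + 1) - y)) ≤ inner ℝ (x k - y) (A k (x k - y)) +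
      (inner ℝ (x k - x (k + 1)) (A k (x k - x (k + 1))) -
        2 * γ k * (φ (x (k + 1)) + ψ (x (k + 1)) - (φ y + ψ y))) := by
  have hγ := h.γ_pos k
  have h1 := (h.step k).le y hy
  have h2 := h.decrease k
  have h3 := h.gradient _ (h.mem k) y hy
  have h4 : inner ℝ (x (k + 1) - x k) (G (x k)) =
      inner ℝ (y - x k) (G (x k)) - inner ℝ (y - x (k + 1)) (G (x k)) := by
    rw [← inner_sub_left]; congr 1; abel
  have h5 := (h.metric k).inner_add_self (x k - x (k + 1)) (x (k + 1) - y)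
  rw [sub_add_sub_cancel, (h.metric k).inner_comm (x k - x (k + 1)) (x (k + 1) - y)] at h5
  have h6 : inner ℝ (y - x (k + 1)) (A k (x k - x (k + 1))) =
      -inner ℝ (x (k + 1) - y) (A k (x k - x (k + 1))) := by
    rw [← inner_neg_left, neg_sub]
  rw [h6] at h1
  have h0 := h.displacement_nonneg k
  set e := inner ℝ (x k - x (k + 1)) (A k (x k - x (k + 1)))
  set b := inner ℝ (x (k + 1) - y) (A k (x k - x (k + 1)))
  have h7 : φ (x (k + 1)) + ψ (x (k + 1)) - (φ y + ψ y) ≤ (γ k)⁻¹ * (δ * e + b) := by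
    have : (γ k)⁻¹ * (δ * e + b) = δ / γ k * e + (γ k)⁻¹ * b := by ring
    rw [this]
    linarith
  have h8 := mul_le_mul_of_nonneg_left h7 hγ.le
  rw [mul_inv_cancel_left₀ hγ.ne'] at h8
  -- The coefficient of `e` obtained is `2 * δ - 1`; bounding it by 1 is enough, as the
  -- displacements are summable when the values are bounded below.
  have h9 : δ * e ≤ 1 * e := mul_le_mul_of_nonneg_right h.δ_lt.le h0
  nlinarith

/-- Passing from `A k` to `V (k + 1)` turns `fejer` into a perturbed monotonicity whose errors,
multiples of the squared displacements, are summable because `F y` bounds the values below. -/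
theorem quasiFejer (h : IsForwardBackwardRun D φ ψ G A ν μ δ θ γbar C γ x)
    {V : ℕ → H →L[ℝ] H} {c : ℕ → ℝ} {κ c₀ c₁ : ℝ} (hV : IsMonotoneRescaling A V c κ c₀ c₁)
    {y : H} (hy : y ∈ D) (hle : ∀ k, φ y + ψ y ≤ φ (x k) + ψ (x k)) :
    (∃ l, Tendsto (fun k => inner ℝ (x k - y) (V k (x k - y))) atTop (𝓝 l)) ∧
      Summable fun k => γ k * (φ (x (k + 1)) + ψ (x (k + 1)) - (φ y + ψ y)) := by
  have hc₁ : 0 < c₁ := hV.c₀_pos.trans_le ((hV.le_c 0).trans (hV.c_le 0))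
  have hnn : ∀ k, 0 ≤ γ k * (φ (x (k + 1)) + ψ (x (k + 1)) - (φ y + ψ y)) := fun k =>
    mul_nonneg (h.γ_pos k).le (by linarith [hle (k + 1)])
  obtain ⟨h1, h2⟩ := quasiFejer_real (u := fun k => inner ℝ (x k - y) (V k (x k - y)))
    (v := fun k => 2 * c₀ * (γ k * (φ (x (k + 1)) + ψ (x (k + 1)) - (φ y + ψ y))))
    (e := fun k => c₁ * inner ℝ (x k - x (k + 1)) (A k (x k - x (k + 1))))
    (fun k => (mul_nonneg hV.κ_pos.le (sq_nonneg _)).trans (hV.lower k _))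
    (fun k => mul_nonneg (by linarith [hV.c₀_pos]) (hnn k))
    ((h.summable_displacement hle).mul_left c₁)
    (fun k => mul_nonneg hc₁.le (h.displacement_nonneg k))
    fun k => by
      have h3 := hV.transfer k _ _ _ (h.fejer k hy)
      have h4 := mul_le_mul_of_nonneg_right (hV.le_c k) (hnn k)
      have h5 := mul_le_mul_of_nonneg_right (hV.c_le k) (h.displacement_nonneg k)
      linarith
  refine ⟨h1, ?_⟩
  have h3 := h2.mul_left (2 * c₀)⁻¹
  have h4 : (2 * c₀) ≠ 0 := by linarith [hV.c₀_pos]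
  simpa only [inv_mul_cancel_left₀ h4] using h3

theorem bounded (h : IsForwardBackwardRun D φ ψ G A ν μ δ θ γbar C γ x)
    {V : ℕ → H →L[ℝ] H} {c : ℕ → ℝ} {κ c₀ c₁ : ℝ} (hV : IsMonotoneRescaling A V c κ c₀ c₁)
    {y : H} (hy : y ∈ D) (hle : ∀ k, φ y + ψ y ≤ φ (x k) + ψ (x k)) :
    ∃ R, ∀ k, ‖x k‖ ≤ R := by
  obtain ⟨⟨l, hl⟩, -⟩ := h.quasiFejer hV hy hle
  obtain ⟨M, hM⟩ := hl.bddAbove_range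
  refine ⟨√(κ⁻¹ * M) + ‖y‖, fun k => ?_⟩
  have h1 : ‖x k - y‖ ≤ √(κ⁻¹ * M) := by
    refine Real.le_sqrt_of_sq_le ?_
    rw [le_inv_mul_iff₀ hV.κ_pos]
    exact (hV.lower k _).trans (hM ⟨k, rfl⟩)
  linarith [norm_le_norm_sub_add (x k) y]

end IsForwardBackwardRun

end ForwardBackward

end VMFBS

/-! ### Convergence of values and of iterates -/

namespace VMFBS

namespace IsForwardBackwardRun

variable {H : Type*} [NormedAddCommGroup H] [InnerProductSpace ℝ H]
  {D : Set H} {φ ψ : H → ℝ} {G : H → H} {A : ℕ → H →L[ℝ] H}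
  {ν μ δ θ γbar C : ℝ} {γ : ℕ → ℝ} {x : ℕ → H}

/-- The gradient inequality is taken at `x (k + 1)`, so the gap is bounded by the optimality
residual: a gradient difference plus displacement over stepsize. -/
theorem value_sub_le (h : IsForwardBackwardRun D φ ψ G A ν μ δ θ γbar C γ x) (k : ℕ) {y : H}
    (hy : y ∈ D) :
    φ (x (k + 1)) + ψ (x (k + 1)) - (φ y + ψ y) ≤
      ‖y - x (k + 1)‖ * ‖G (x (k + 1)) - G (x k)‖ + √μ * ‖y - x (k + 1)‖ *
        (√(inner ℝ (x k - x (k + 1)) (A k (x k - x (k + 1)))) / γ k) := by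
  have hγ := h.γ_pos k
  have h1 := (h.step k).le y hy
  have h2 := h.gradient _ (h.mem (k + 1)) y hy
  have h3 : inner ℝ (x (k + 1) - y) (A k (x k - x (k + 1))) ≤
      (√μ * ‖y - x (k + 1)‖) * √(inner ℝ (x k - x (k + 1)) (A k (x k - x (k + 1)))) := by
    refine ((h.metric k).inner_le h.ν_pos _ _).trans ?_
    refine mul_le_mul_of_nonneg_right ?_ (Real.sqrt_nonneg _)
    rw [norm_sub_rev]
    exact (h.metric k).sqrt_upper h.μ_nonneg _
  have h4 : inner ℝ (y - x (k + 1)) (A k (x k - x (k + 1))) =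
      -inner ℝ (x (k + 1) - y) (A k (x k - x (k + 1))) := by
    rw [← inner_neg_left, neg_sub]
  have h5 : inner ℝ (y - x (k + 1)) (G (x k)) - inner ℝ (y - x (k + 1)) (G (x (k + 1))) ≤
      ‖y - x (k + 1)‖ * ‖G (x (k + 1)) - G (x k)‖ := by
    rw [← inner_sub_right, norm_sub_rev (G (x (k + 1)))]
    exact real_inner_le_norm _ _
  have h6 := mul_le_mul_of_nonneg_left h3 (inv_pos.2 hγ).le
  rw [h4] at h1
  rw [div_eq_inv_mul]
  linarith

/-- Monotonicity in the stepsize, between `γ k` and `γ k / θ`, moves the information about the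
rejected point to the accepted one, and keeps the rejected point close to `x k`. -/
theorem displacement_of_backtrack (h : IsForwardBackwardRun D φ ψ G A ν μ δ θ γbar C γ x) {k : ℕ}
    {z : H} (hz : IsForwardBackwardStep D ψ (A k) (x k) (G (x k)) (γ k / θ) z)
    (hC : √(inner ℝ (x k - z) (A k (x k - z))) / (γ k / θ) ≤ C * ‖G z - G (x k)‖) :
    √(inner ℝ (x k - x (k + 1)) (A k (x k - x (k + 1)))) / γ k ≤
        θ⁻¹ * (C * ‖G z - G (x k)‖) ∧
      √ν * ‖x k - z‖ ≤ θ⁻¹ * (√μ * ‖x (k + 1) - x k‖) := by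
  have hγ := h.γ_pos k
  have hθ := h.θ_mem.1
  have hlt : γ k < γ k / θ := by
    rw [lt_div_iff₀ hθ]
    exact mul_lt_of_lt_one_right hγ h.θ_mem.2
  obtain ⟨h1, h2⟩ := (h.step k).monotone (h.metric k) h.ν_pos hγ hlt hz
  constructor
  · calc √(inner ℝ (x k - x (k + 1)) (A k (x k - x (k + 1)))) / γ k
        ≤ √(inner ℝ (x k - z) (A k (x k - z))) / γ k := by gcongr
      _ = θ⁻¹ * (√(inner ℝ (x k - z) (A k (x k - z))) / (γ k / θ)) := by field_simp
      _ ≤ _ := by gcongr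
  · refine ((h.metric k).sqrt_lower h.ν_pos _).trans ?_
    have h3 : √(inner ℝ (x k - z) (A k (x k - z))) =
        γ k * θ⁻¹ * (√(inner ℝ (x k - z) (A k (x k - z))) / (γ k / θ)) := by field_simp
    rw [h3]
    calc _ ≤ γ k * θ⁻¹ * (√(inner ℝ (x k - x (k + 1)) (A k (x k - x (k + 1)))) / γ k) := by
          gcongr
      _ = θ⁻¹ * √(inner ℝ (x k - x (k + 1)) (A k (x k - x (k + 1)))) := by field_simp
      _ ≤ _ := by
          gcongr
          rw [norm_sub_rev]
          exact (h.metric k).sqrt_upper h.μ_nonneg _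

variable {V : ℕ → H →L[ℝ] H} {c : ℕ → ℝ} {κ c₀ c₁ : ℝ}

theorem isLittleO (h : IsForwardBackwardRun D φ ψ G A ν μ δ θ γbar C γ x)
    (hV : IsMonotoneRescaling A V c κ c₀ c₁) {y : H} (hy : y ∈ D)
    (hmin : ∀ v ∈ D, φ y + ψ y ≤ φ v + ψ v) {ι : ℝ} (hι : 0 < ι) (hγ : ∀ k, ι ≤ γ k) :
    (fun k => φ (x k) + ψ (x k) - (φ y + ψ y)) =o[atTop] fun k : ℕ => 1 / (k : ℝ) := by
  have hs : Summable fun k => φ (x (k + 1)) + ψ (x (k + 1)) - (φ y + ψ y) := by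
    have hnn : ∀ k, 0 ≤ φ (x (k + 1)) + ψ (x (k + 1)) - (φ y + ψ y) := fun k =>
      sub_nonneg.2 (hmin _ (h.mem _))
    refine Summable.of_nonneg_of_le hnn (fun k => ?_)
      ((h.quasiFejer hV hy fun k => hmin _ (h.mem k)).2.mul_left ι⁻¹)
    rw [le_inv_mul_iff₀ hι]
    exact mul_le_mul_of_nonneg_right (hγ k) (hnn k)
  have hs' := (summable_nat_add_iff (f := fun k => φ (x k) + ψ (x k) - (φ y + ψ y)) 1).1 hs
  have := tendsto_nat_mul_of_antitone_of_summable
    (fun i j hij => sub_le_sub_right (h.antitone hij) _) hs'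
  refine (isLittleO_iff_tendsto' ?_).2 (this.congr fun k => ?_)
  -- The index 0 is discarded because there `1 / (k : ℝ)` is 0.
  · filter_upwards [eventually_gt_atTop 0] with k hk h0
    have : (k : ℝ) ≠ 0 := by positivity
    exact absurd h0 (one_div_ne_zero this)
  · rw [one_div, div_inv_eq_mul, mul_comm]

variable [CompleteSpace H]

/-- The path has finite length: `t ≤ γ k + t² / γ k` for `t = ‖x k - x (k + 1)‖`, and both terms on
the right are summable. Closed sublevel sets keep the limit in `D`. -/
theorem exists_tendsto_of_summable_stepsize
    (h : IsForwardBackwardRun D φ ψ G A ν μ δ θ γbar C γ x) (hγ : Summable γ) {m : ℝ}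
    (hm : ∀ k, m ≤ φ (x k) + ψ (x k)) : ∃ a ∈ D, Tendsto x atTop (𝓝 a) := by
  have hs : Summable fun k => dist (x k) (x (k + 1)) := by
    refine Summable.of_nonneg_of_le (fun k => dist_nonneg) (fun k => ?_)
      (hγ.add ((h.summable_displacement_div hm).mul_left ν⁻¹))
    have hγk := h.γ_pos k
    have h1 : ‖x k - x (k + 1)‖ ^ 2 ≤
        ν⁻¹ * inner ℝ (x k - x (k + 1)) (A k (x k - x (k + 1))) := by
      rw [le_inv_mul_iff₀ h.ν_pos]
      exact (h.metric k).lower _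
    rw [dist_eq_norm, mul_div_assoc', ← sub_nonneg]
    have h2 : γ k + ν⁻¹ * inner ℝ (x k - x (k + 1)) (A k (x k - x (k + 1))) / γ k
        - ‖x k - x (k + 1)‖ = (γ k * γ k +
          ν⁻¹ * inner ℝ (x k - x (k + 1)) (A k (x k - x (k + 1))) -
            ‖x k - x (k + 1)‖ * γ k) / γ k := by
      field_simp
    rw [h2]
    refine div_nonneg ?_ hγk.le
    nlinarith [sq_nonneg (γ k - ‖x k - x (k + 1)‖), norm_nonneg (x k - x (k + 1))]
  obtain ⟨a, ha⟩ := cauchySeq_tendsto_of_complete (cauchySeq_of_summable_dist hs)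
  refine ⟨a, ?_, ha⟩
  exact ((h.isClosed (φ (x 0) + ψ (x 0))).mem_of_tendsto ha
    (Eventually.of_forall fun k => ⟨h.mem k, h.antitone k.zero_le⟩)).1

theorem exists_value_lt (h : IsForwardBackwardRun D φ ψ G A ν μ δ θ γbar C γ x)
    (hV : IsMonotoneRescaling A V c κ c₀ c₁) {y : H} (hy : y ∈ D) {ε : ℝ} (hε : 0 < ε) :
    ∃ k, φ (x k) + ψ (x k) < φ y + ψ y + ε := by
  by_contra! hcon
  have hle : ∀ k, φ y + ψ y ≤ φ (x k) + ψ (x k) := fun k => by linarith [hcon k]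
  have hγs : Summable γ := by
    refine Summable.of_nonneg_of_le (fun k => (h.γ_pos k).le) (fun k => ?_)
      ((h.quasiFejer hV hy hle).2.mul_left ε⁻¹)
    rw [le_inv_mul_iff₀ hε, mul_comm]
    exact mul_le_mul_of_nonneg_left (by linarith [hcon (k + 1)]) (h.γ_pos k).le
  obtain ⟨a, haD, ha⟩ := h.exists_tendsto_of_summable_stepsize hγs hle
  have ha1 : Tendsto (fun k => x (k + 1)) atTop (𝓝 a) := (tendsto_add_atTop_iff_nat 1).2 ha
  have hγbar : 0 < γbar := (h.γ_pos 0).trans_le (h.γ_le 0)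
  -- When `γ k = γbar` nothing was rejected and `a` is a dummy witness; `γ k → 0` excludes this case
  -- eventually.
  have hz' : ∀ k, ∃ z, γ k = γbar ∨
      IsForwardBackwardStep D ψ (A k) (x k) (G (x k)) (γ k / θ) z ∧
        √(inner ℝ (x k - z) (A k (x k - z))) / (γ k / θ) ≤ C * ‖G z - G (x k)‖ := fun k => by
    rcases h.backtrack k with hk | ⟨z, hz⟩
    · exact ⟨a, Or.inl hk⟩
    · exact ⟨z, Or.inr hz⟩
  choose z hz using hz'
  have hev : ∀ᶠ k in atTop, IsForwardBackwardStep D ψ (A k) (x k) (G (x k)) (γ k / θ) (z k) ∧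
      √(inner ℝ (x k - z k) (A k (x k - z k))) / (γ k / θ) ≤ C * ‖G (z k) - G (x k)‖ := by
    filter_upwards [hγs.tendsto_atTop_zero.eventually_lt_const hγbar] with k hk
    exact (hz k).resolve_left hk.ne
  have hνs : 0 < √ν := Real.sqrt_pos.2 h.ν_pos
  have hxz : Tendsto (fun k => x k - z k) atTop (𝓝 0) := by
    rw [tendsto_zero_iff_norm_tendsto_zero]
    have hb : Tendsto (fun k => (√ν)⁻¹ * (θ⁻¹ * (√μ * ‖x (k + 1) - x k‖))) atTop (𝓝 0) := by
      have := ((((ha1.sub ha).norm).const_mul √μ).const_mul θ⁻¹).const_mul (√ν)⁻¹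
      simpa using this
    refine squeeze_zero' (Eventually.of_forall fun k => norm_nonneg _) ?_ hb
    filter_upwards [hev] with k hk
    rw [le_inv_mul_iff₀ hνs]
    exact (h.displacement_of_backtrack hk.1 hk.2).2
  have hza : Tendsto z atTop (𝓝 a) := by
    simpa using ha.sub hxz
  have hG : ∀ {w : ℕ → H}, Tendsto w atTop (𝓝 a) → (∀ᶠ k in atTop, w k ∈ D) →
      Tendsto (fun k => G (w k)) atTop (𝓝 (G a)) := fun hw hwD =>
    (h.continuousOn a haD).tendsto.comp (tendsto_nhdsWithin_iff.2 ⟨hw, hwD⟩)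
  have hGx := hG ha (Eventually.of_forall h.mem)
  have hGx1 := hG ha1 (Eventually.of_forall fun k => h.mem (k + 1))
  have hGz := hG hza (hev.mono fun k hk => hk.1.mem)
  have hlim : Tendsto (fun k => ‖y - x (k + 1)‖ * ‖G (x (k + 1)) - G (x k)‖ +
      √μ * ‖y - x (k + 1)‖ * (θ⁻¹ * (C * ‖G (z k) - G (x k)‖))) atTop (𝓝 0) := by
    have hn := (ha1.const_sub y).norm
    have h1 := hn.mul (hGx1.sub hGx).norm
    have h2 := (hn.const_mul √μ).mul (((hGz.sub hGx).norm.const_mul C).const_mul θ⁻¹)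
    simpa using h1.add h2
  have hfin : ε ≤ 0 := by
    refine ge_of_tendsto hlim ?_
    filter_upwards [hev] with k hk
    have h1 := h.value_sub_le k hy
    have h2 := (h.displacement_of_backtrack hk.1 hk.2).1
    have h3 := mul_le_mul_of_nonneg_left h2
      (mul_nonneg (Real.sqrt_nonneg μ) (norm_nonneg (y - x (k + 1))))
    linarith [hcon (k + 1)]
  linarith

/-- For each `y ∈ D` and `ε > 0` the iterates eventually stay in the closed convex sublevel set at
`F y + ε`, which therefore contains their weak limits. -/
theorem isMinimizer_of_tendsto_inner (h : IsForwardBackwardRun D φ ψ G A ν μ δ θ γbar C γ x)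
    (hV : IsMonotoneRescaling A V c κ c₀ c₁) {l : Filter ℕ} [l.NeBot] (hl : l ≤ atTop) {a : H}
    (ha : ∀ v, Tendsto (fun k => inner ℝ (x k) v) l (𝓝 (inner ℝ a v))) :
    a ∈ D ∧ ∀ y ∈ D, φ a + ψ a ≤ φ y + ψ y := by
  have key : ∀ y ∈ D, ∀ ε > 0, a ∈ {u ∈ D | φ u + ψ u ≤ φ y + ψ y + ε} := fun y hy ε hε => by
    obtain ⟨N, hN⟩ := h.exists_value_lt hV hy hε
    refine mem_of_tendsto_inner (h.convex _) (h.isClosed _) (hl ?_) ha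
    filter_upwards [eventually_ge_atTop N] with k hk
    exact ⟨h.mem k, (h.antitone hk).trans hN.le⟩
  exact ⟨(key _ h.init 1 one_pos).1,
    fun y hy => le_of_forall_pos_le_add fun ε hε => (key y hy ε hε).2⟩

theorem tendsto_inner (h : IsForwardBackwardRun D φ ψ G A ν μ δ θ γbar C γ x)
    (hV : IsMonotoneRescaling A V c κ c₀ c₁) {y : H} (hy : y ∈ D)
    (hmin : ∀ v ∈ D, φ y + ψ y ≤ φ v + ψ v) :
    ∃ a ∈ D, (∀ v ∈ D, φ a + ψ a ≤ φ v + ψ v) ∧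
      ∀ v, Tendsto (fun k => inner ℝ (x k) v) atTop (𝓝 (inner ℝ a v)) := by
  obtain ⟨R, hR⟩ := h.bounded hV hy fun k => hmin _ (h.mem k)
  have hcluster : ∀ U : Ultrafilter ℕ, (U : Filter ℕ) ≤ atTop → ∃ a,
      (a ∈ D ∧ ∀ v ∈ D, φ a + ψ a ≤ φ v + ψ v) ∧
        ∀ v, Tendsto (fun k => inner ℝ (x k) v) U (𝓝 (inner ℝ a v)) := fun U hU => by
    obtain ⟨a, ha⟩ := exists_tendsto_inner_of_ultrafilter U (Eventually.of_forall hR)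
    exact ⟨a, h.isMinimizer_of_tendsto_inner hV hU ha, ha⟩
  have hpos : ∀ k u, 0 ≤ inner ℝ u (V k u) := fun k u =>
    (mul_nonneg hV.κ_pos.le (sq_nonneg _)).trans (hV.lower k u)
  -- Opial's inequality for the varying norms of `V k`. Used along two ultrafilters with the roles
  -- of `a` and `b` exchanged, it forces `a = b`.
  have hle : ∀ U : Ultrafilter ℕ, (U : Filter ℕ) ≤ atTop → ∀ a b la lb,
      (∀ v, Tendsto (fun k => inner ℝ (x k) v) U (𝓝 (inner ℝ a v))) →
      Tendsto (fun k => inner ℝ (x k - a) (V k (x k - a))) atTop (𝓝 la) →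
      Tendsto (fun k => inner ℝ (x k - b) (V k (x k - b))) atTop (𝓝 lb) →
      la + κ * ‖a - b‖ ^ 2 ≤ lb := fun U hU a b la lb ha hla hlb => by
    obtain ⟨w, hw⟩ := exists_tendsto_apply_of_antitone hV.symm hpos hV.antitone (a - b)
    -- A bounded, weakly null factor against a strongly convergent one; this is why strong
    -- convergence of `V k` is needed.
    have hcross : Tendsto (fun k => inner ℝ (x k - a) (V k (a - b))) U (𝓝 0) := by
      have h1 : Tendsto (fun k => inner ℝ (x k - a) w) U (𝓝 0) := by
        simpa [inner_sub_left] using (ha w).sub_const (inner ℝ a w)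
      have h2 : Tendsto (fun k => inner ℝ (x k - a) (V k (a - b) - w)) U (𝓝 0) := by
        have hb : Tendsto (fun k => (R + ‖a‖) * ‖V k (a - b) - w‖) U (𝓝 0) := by
          have := ((hw.sub_const w).norm.const_mul (R + ‖a‖)).mono_left hU
          simpa using this
        refine squeeze_zero_norm (fun k => (norm_inner_le_norm _ _).trans ?_) hb
        gcongr
        exact (norm_sub_le _ _).trans (by gcongr; exact hR k)
      simpa [← inner_add_right] using h1.add h2
    have hlim := (hla.mono_left hU).add (hcross.const_mul 2)
    rw [mul_zero, add_zero] at hlim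
    refine le_of_tendsto_of_tendsto' (hlim.add_const (κ * ‖a - b‖ ^ 2)) (hlb.mono_left hU)
      fun k => ?_
    have h1 := hV.lower k (a - b)
    have h2 : inner ℝ (a - b) (V k (x k - a)) = inner ℝ (x k - a) (V k (a - b)) := by
      rw [← hV.symm, real_inner_comm]
    have h3 : inner ℝ (x k - b) (V k (x k - b)) = inner ℝ (x k - a) (V k (x k - a)) +
        2 * inner ℝ (x k - a) (V k (a - b)) + inner ℝ (a - b) (V k (a - b)) := by
      rw [← sub_add_sub_cancel (x k) a b, map_add, inner_add_left, inner_add_right,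
        inner_add_right, h2]
      ring
    rw [h3]
    linarith
  obtain ⟨a, ⟨haD, hamin⟩, ha⟩ := hcluster (Ultrafilter.of atTop) (Ultrafilter.of_le _)
  refine ⟨a, haD, hamin, fun v => (tendsto_iff_ultrafilter _ _ _).2 fun U hU => ?_⟩
  obtain ⟨b, ⟨hbD, hbmin⟩, hb⟩ := hcluster U hU
  obtain ⟨la, hla⟩ := (h.quasiFejer hV haD fun k => hamin _ (h.mem k)).1
  obtain ⟨lb, hlb⟩ := (h.quasiFejer hV hbD fun k => hbmin _ (h.mem k)).1
  have h1 := hle _ (Ultrafilter.of_le _) a b la lb ha hla hlb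
  have h2 := hle U hU b a lb la hb hlb hla
  have h3 : a = b := by
    rw [← sub_eq_zero, ← norm_eq_zero]
    rw [norm_sub_rev b a] at h2
    have hκ := hV.κ_pos
    have : κ * ‖a - b‖ ^ 2 ≤ 0 := by linarith
    have h4 : ‖a - b‖ ^ 2 ≤ 0 := by nlinarith [sq_nonneg ‖a - b‖]
    nlinarith [sq_nonneg ‖a - b‖, norm_nonneg (a - b)]
  rw [h3]
  exact hb v

theorem tendsto_norm_atTop (h : IsForwardBackwardRun D φ ψ G A ν μ δ θ γbar C γ x)
    (hV : IsMonotoneRescaling A V c κ c₀ c₁)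
    (hmin : ¬∃ a ∈ D, ∀ y ∈ D, φ a + ψ a ≤ φ y + ψ y) :
    Tendsto (fun k => ‖x k‖) atTop atTop := by
  by_contra hcon
  simp only [tendsto_atTop, not_forall] at hcon
  obtain ⟨R, hR⟩ := hcon
  have hfreq : ∃ᶠ k in atTop, ‖x k‖ ≤ R :=
    (not_eventually.1 hR).mono fun k hk => (not_le.1 hk).le
  have hne : (atTop ⊓ 𝓟 {k | ‖x k‖ ≤ R}).NeBot := frequently_mem_iff_neBot.1 hfreq
  have hU := Ultrafilter.of_le (atTop ⊓ 𝓟 {k | ‖x k‖ ≤ R})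
  obtain ⟨a, ha⟩ := exists_tendsto_inner_of_ultrafilter (u := x) (R := R)
    (Ultrafilter.of (atTop ⊓ 𝓟 {k | ‖x k‖ ≤ R}))
    (hU (mem_inf_of_right (mem_principal_self _)))
  exact hmin ⟨a, h.isMinimizer_of_tendsto_inner hV (hU.trans inf_le_left) ha⟩

end IsForwardBackwardRun

end VMFBS

namespace VMFBS

/-! ### Monotone rescaling of the metrics under H4 or H5 -/

section Rescaling

variable {H : Type*} [NormedAddCommGroup H] [InnerProductSpace ℝ H]
  {A : ℕ → H →L[ℝ] H} {ν μ : ℝ}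

/-- Dividing `P k` by the product of the `1 + η j`, `j < k`, absorbs the growth factors; that
product lies between 1 and `exp (∑ η)`, so uniform ellipticity survives. -/
theorem exists_isMonotoneRescaling_of_transfer {P : ℕ → H →L[ℝ] H} {κ M c₀ c₁ : ℝ}
    {c η : ℕ → ℝ} (hP : ∀ k, IsMetricOperator κ M (P k)) (hκ : 0 < κ) (hc₀ : 0 < c₀)
    (hle_c : ∀ k, c₀ ≤ c k) (hc_le : ∀ k, c k ≤ c₁) (hη0 : ∀ k, 0 ≤ η k) (hη : Summable η)
    (hmono : ∀ k x, inner ℝ x (P (k + 1) x) ≤ (1 + η k) * inner ℝ x (P k x))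
    (htransfer : ∀ k a b r, inner ℝ a (A k a) ≤ inner ℝ b (A k b) + r →
      inner ℝ a (P (k + 1) a) ≤ (1 + η k) * (inner ℝ b (P k b) + c k * r)) :
    ∃ (V : ℕ → H →L[ℝ] H) (d : ℕ → ℝ) (κ' d₀ d₁ : ℝ),
      IsMonotoneRescaling A V d κ' d₀ d₁ := by
  let a : ℕ → ℝ := fun n => ∏ j ∈ Finset.range n, (1 + η j)
  have ha1 : ∀ n, 1 ≤ a n := one_le_prod_one_add hη0
  have ha0 : ∀ n, 0 < a n := fun n => one_pos.trans_le (ha1 n)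
  have haE : ∀ n, a n ≤ Real.exp (∑' j, η j) := prod_one_add_le_exp_tsum hη0 hη
  have hsucc : ∀ n, a (n + 1) = (1 + η n) * a n := fun n => by
    simp only [a, Finset.prod_range_succ]
    ring
  have hE := Real.exp_pos (∑' j, η j)
  have hη1 : ∀ k, 0 < 1 + η k := fun k => by linarith [hη0 k]
  refine ⟨fun k => (a k)⁻¹ • P k, fun k => (a k)⁻¹ * c k, (Real.exp (∑' j, η j))⁻¹ * κ,
    (Real.exp (∑' j, η j))⁻¹ * c₀, c₁, ?_⟩
  have hval : ∀ k x, inner ℝ x (((a k)⁻¹ • P k) x) = (a k)⁻¹ * inner ℝ x (P k x) := fun k x => by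
    simp [inner_smul_right]
  have hdiv : ∀ k s, (a (k + 1))⁻¹ * ((1 + η k) * s) = (a k)⁻¹ * s := fun k s => by
    rw [hsucc]
    have := (hη1 k).ne'
    field_simp
  refine ⟨by positivity, by positivity, fun k x y => ?_, fun k x => ?_, fun k x => ?_,
    fun k => ?_, fun k => ?_, fun k u v r h => ?_⟩
  · simp [inner_smul_left, inner_smul_right, (hP k).symm]
  · rw [hval, mul_assoc]
    exact mul_le_mul (inv_anti₀ (ha0 k) (haE k)) ((hP k).lower x) (by positivity)
      (inv_nonneg.2 (ha0 k).le)
  · rw [hval, hval, ← hdiv k]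
    exact mul_le_mul_of_nonneg_left (hmono k x) (inv_nonneg.2 (ha0 _).le)
  · exact mul_le_mul (inv_anti₀ (ha0 k) (haE k)) (hle_c k) hc₀.le (inv_nonneg.2 (ha0 k).le)
  · exact (mul_le_of_le_one_left (hc₀.le.trans (hle_c k)) (inv_le_one_of_one_le₀ (ha1 k))).trans
      (hc_le k)
  · rw [hval, hval, mul_assoc, ← mul_add, ← hdiv k]
    exact mul_le_mul_of_nonneg_left (htransfer k u v r h) (inv_nonneg.2 (ha0 _).le)

theorem exists_isMonotoneRescaling_of_le (hA : ∀ k, IsMetricOperator ν μ (A k)) (hν : 0 < ν)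
    {η : ℕ → ℝ} (hη0 : ∀ k, 0 ≤ η k) (hη : Summable η)
    (hmono : ∀ k x, inner ℝ x (A (k + 1) x) ≤ (1 + η k) * inner ℝ x (A k x)) :
    ∃ (V : ℕ → H →L[ℝ] H) (d : ℕ → ℝ) (κ' d₀ d₁ : ℝ),
      IsMonotoneRescaling A V d κ' d₀ d₁ := by
  refine exists_isMonotoneRescaling_of_transfer (c := fun _ => 1) hA hν one_pos
    (fun _ => le_rfl) (fun _ => le_rfl) hη0 hη hmono fun k a b r h => ?_
  rw [one_mul]
  exact (hmono k a).trans (mul_le_mul_of_nonneg_left h (by linarith [hη0 k]))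

/-- The case of H5: consecutive metrics need not be comparable with summable error, but each is
nearly a multiple of the ambient one. Thus `P` is the identity, and `M k / m k ≤ 1 + ν⁻¹ * (M k - m
k)` is the price of passing through it. -/
theorem exists_isMonotoneRescaling_of_summable (hν : 0 < ν) (hμ : 0 < μ) {m M : ℕ → ℝ} (hνm : ∀ k, ν ≤ m k) (hmM : ∀ k, m k ≤ M k)
    (hMμ : ∀ k, M k ≤ μ) (hbounds : ∀ k, IsMetricOperator (m k) (M k) (A k))
    (hs : Summable fun k => M k - m k) :
    ∃ (V : ℕ → H →L[ℝ] H) (d : ℕ → ℝ) (κ' d₀ d₁ : ℝ),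
      IsMonotoneRescaling A V d κ' d₀ d₁ := by
  have hη0 : ∀ k, 0 ≤ ν⁻¹ * (M k - m k) := fun k =>
    mul_nonneg (inv_nonneg.2 hν.le) (sub_nonneg.2 (hmM k))
  have hm0 : ∀ k, 0 < m k := fun k => hν.trans_le (hνm k)
  have hM : ∀ k, M k ≤ m k * (1 + ν⁻¹ * (M k - m k)) := fun k => by
    have h1 : 1 * (M k - m k) ≤ m k * ν⁻¹ * (M k - m k) := by
      refine mul_le_mul_of_nonneg_right ?_ (sub_nonneg.2 (hmM k))
      rw [← div_eq_mul_inv, le_div_iff₀ hν, one_mul]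
      exact hνm k
    linarith
  have hden : ∀ k, 0 < m k * (1 + ν⁻¹ * (M k - m k)) := fun k =>
    mul_pos (hm0 k) (by linarith [hη0 k])
  refine exists_isMonotoneRescaling_of_transfer (P := fun _ => ContinuousLinearMap.id ℝ H)
    (κ := 1) (M := 1) (c := fun k => (m k * (1 + ν⁻¹ * (M k - m k)))⁻¹)
    (c₀ := (μ * (1 + ν⁻¹ * μ))⁻¹) (c₁ := ν⁻¹) (η := fun k => ν⁻¹ * (M k - m k))
    (fun k => ⟨fun x y => rfl, fun x => ?_, fun x => ?_⟩) one_pos (by positivity)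
    (fun k => ?_) (fun k => ?_) hη0 (hs.mul_left _) (fun k x => ?_) fun k a b r h => ?_
  · simp
  · simp
  · refine inv_anti₀ (hden k) (mul_le_mul ((hmM k).trans (hMμ k)) ?_ (by linarith [hη0 k]) hμ.le)
    gcongr
    linarith [hMμ k, hm0 k]
  · refine inv_anti₀ hν ((hνm k).trans (le_mul_of_one_le_right (hm0 k).le ?_))
    linarith [hη0 k]
  · exact le_mul_of_one_le_left real_inner_self_nonneg (by linarith [hη0 k])
  · simp only [ContinuousLinearMap.id_apply, real_inner_self_eq_norm_sq]
    have h1 := (hbounds k).lower a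
    have h2 := (hbounds k).upper b
    have h3 := mul_le_mul_of_nonneg_right (hM k) (sq_nonneg ‖b‖)
    have h4 : (1 + ν⁻¹ * (M k - m k)) *
        (‖b‖ ^ 2 + (m k * (1 + ν⁻¹ * (M k - m k)))⁻¹ * r) =
        (m k)⁻¹ * (m k * (1 + ν⁻¹ * (M k - m k)) * ‖b‖ ^ 2 + r) := by
      have h5 : (1 + ν⁻¹ * (M k - m k)) ≠ 0 := by linarith [hη0 k]
      have h6 := (hm0 k).ne'
      generalize 1 + ν⁻¹ * (M k - m k) = t at h5 ⊢
      field_simp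
    rw [h4, le_inv_mul_iff₀ (hm0 k)]
    linarith

end Rescaling

/-! ### Convex functions: gradients and lower bounds -/

section Gradient

variable {H : Type*} [NormedAddCommGroup H] [InnerProductSpace ℝ H]

theorem HasGateauxGradient.apply_eq {B B' : H → H → ℝ} {h : H → EReal} {x u u' : H}
    (hu : HasGateauxGradient B h x u) (hu' : HasGateauxGradient B' h x u') (d : H) :
    B d u = B' d u' :=
  EReal.coe_injective (tendsto_nhds_unique (hu.2 d) (hu'.2 d))

theorem hasGateauxGradient_grad {B : H → H → ℝ} {h : H → EReal} {x u : H}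
    (hu : HasGateauxGradient B h x u) : HasGateauxGradient B h x (grad B h x) :=
  Classical.epsilon_spec (p := HasGateauxGradient B h x) ⟨u, hu⟩

namespace IsGammaZero

variable {h : H → EReal}

theorem coe_toReal (hh : IsGammaZero h) {x : H} (hx : x ∈ dom h) : ((h x).toReal : EReal) = h x :=
  EReal.coe_toReal (ne_of_lt hx) (hh.ne_bot x)

theorem apply_le_coe (hh : IsGammaZero h) {x y : H} (hx : x ∈ dom h) (hy : y ∈ dom h) {a b : ℝ}
    (ha : 0 < a) (hb : 0 < b) (hab : a + b = 1) :
    h (a • x + b • y) ≤ ((a * (h x).toReal + b * (h y).toReal : ℝ) : EReal) := by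
  have := hh.convex x y a b ha hb hab
  rwa [← hh.coe_toReal hx, ← hh.coe_toReal hy, ← EReal.coe_mul, ← EReal.coe_mul,
    ← EReal.coe_add] at this

theorem mem_dom_of_le {E : Type*} {h : E → EReal} (x : E) {r : ℝ} (hr : h x ≤ (r : EReal)) : x ∈ dom h :=
  hr.trans_lt (EReal.coe_lt_top r)

theorem toReal_le (hh : IsGammaZero h) {x : H} {r : ℝ} (hr : h x ≤ (r : EReal)) :
    (h x).toReal ≤ r := by
  rwa [← hh.coe_toReal (mem_dom_of_le x hr), EReal.coe_le_coe_iff] at hr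

theorem toReal_add_smul_sub_le (hh : IsGammaZero h) {x y : H} (hx : x ∈ dom h) (hy : y ∈ dom h)
    {t : ℝ} (ht : t ∈ Ioo (0 : ℝ) 1) :
    h (x + t • (y - x)) ≤
      (((h x).toReal + t * ((h y).toReal - (h x).toReal) : ℝ) : EReal) := by
  have h1 := hh.apply_le_coe hx hy (a := 1 - t) (b := t) (by linarith [ht.2]) ht.1 (by ring)
  have h2 : (1 - t) • x + t • y = x + t • (y - x) := by module
  have h3 : (1 - t) * (h x).toReal + t * (h y).toReal =
      (h x).toReal + t * ((h y).toReal - (h x).toReal) := by ring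
  rwa [h2, h3] at h1

theorem gradient_inequality (hh : IsGammaZero h) {x u y : H}
    (hu : HasGateauxGradient (inner ℝ) h x u) (hy : y ∈ dom h) :
    (h x).toReal + inner ℝ (y - x) u ≤ (h y).toReal := by
  have hx := hu.1
  have hlim := (hu.2 (y - x)).mono_left (nhdsGT_le_nhdsNE (0 : ℝ))
  have hle : ((inner ℝ (y - x) u : ℝ) : EReal) ≤ (((h y).toReal - (h x).toReal : ℝ) : EReal) := by
    refine le_of_tendsto hlim ?_
    filter_upwards [Ioo_mem_nhdsGT (one_pos : (0 : ℝ) < 1)] with t ht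
    have h1 := hh.toReal_add_smul_sub_le hx hy ht
    have h2 := hh.toReal_le h1
    rw [← hh.coe_toReal (mem_dom_of_le _ h1), ← hh.coe_toReal hx, ← EReal.coe_sub,
      ← EReal.coe_div, EReal.coe_le_coe_iff, EReal.toReal_coe, div_le_iff₀ ht.1]
    linarith
  have := EReal.coe_le_coe_iff.1 hle
  linarith

/-- Lower semicontinuity gives `h > h u - 1` on a ball of radius `r`; beyond it, convexity on the
segment from `u` to `y`, at the point at distance `r / 2` from `u`, limits the decrease to slope `2
/ r`. This cone bound avoids a separation theorem. -/
theorem exists_affine_lower_bound (hh : IsGammaZero h) :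
    ∃ (u : H) (m L : ℝ), 0 ≤ L ∧ ∀ y ∈ dom h, m - L * ‖y - u‖ ≤ (h y).toReal := by
  obtain ⟨u, hu⟩ := hh.dom_nonempty
  have hlt : (((h u).toReal - 1 : ℝ) : EReal) < h u := by
    rw [← hh.coe_toReal hu, EReal.coe_lt_coe_iff, EReal.toReal_coe]
    linarith
  obtain ⟨r, hr, hball⟩ := Metric.eventually_nhds_iff.1 (hh.lsc u _ hlt)
  refine ⟨u, (h u).toReal - 1, 2 / r, by positivity, fun y hy => ?_⟩
  rcases lt_or_ge ‖y - u‖ r with hyr | hyr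
  · have h1 : _ < h y := hball (y := y) (by rwa [dist_eq_norm])
    rw [← hh.coe_toReal hy, EReal.coe_lt_coe_iff] at h1
    have : 0 ≤ 2 / r * ‖y - u‖ := by positivity
    linarith
  · have hy0 : 0 < ‖y - u‖ := hr.trans_le hyr
    set t : ℝ := r / (2 * ‖y - u‖) with ht
    have ht0 : 0 < t := by positivity
    have ht1 : t < 1 := by
      rw [ht, div_lt_one (by positivity)]
      linarith
    have h1 := hh.toReal_add_smul_sub_le hu hy ⟨ht0, ht1⟩
    have h2 := (hball (y := u + t • (y - u)) (by
      rw [dist_eq_norm, add_sub_cancel_left, norm_smul, Real.norm_of_nonneg ht0.le, ht]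
      have : r / (2 * ‖y - u‖) * ‖y - u‖ = r / 2 := by field_simp
      rw [this]
      linarith)).trans_le h1
    rw [EReal.coe_lt_coe_iff] at h2
    have h3 : -1 < t * ((h y).toReal - (h u).toReal) := by linarith
    have h4 : t * (2 / r * ‖y - u‖) = 1 := by
      rw [ht]
      field_simp
    have h5 : 0 < t * ((h y).toReal - (h u).toReal + 2 / r * ‖y - u‖) := by
      rw [mul_add, h4]
      linarith
    have h6 := (mul_pos_iff_of_pos_left ht0).1 h5
    linarith

end IsGammaZero

end Gradient

/-! ### Existence and variational inequality of the proximal point -/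

section Prox

variable {H : Type*} [NormedAddCommGroup H] [InnerProductSpace ℝ H]

theorem mem_argminSet_iff {E : Type*} {h : E → EReal} {x : E} : x ∈ argminSet h ↔ ∀ y, h x ≤ h y :=
  ⟨fun hx y => hx.trans_le (iInf_le h y), fun hx => le_antisymm (le_iInf hx) (iInf_le h x)⟩

variable {g : H → EReal} {A : H →L[ℝ] H} {ν μ c : ℝ}

/-- The objective function of the proximity operator, in real terms. -/
noncomputable def proxObjective (g : H → EReal) (A : H →L[ℝ] H) (c : ℝ) (x y : H) : ℝ :=
  c * (g y).toReal + 1 / 2 * inner ℝ (y - x) (A (y - x))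

theorem bddBelow_proxObjective (hg : IsGammaZero g) (hA : IsMetricOperator ν μ A) (hν : 0 < ν)
    (hc : 0 < c) (x : H) : BddBelow (proxObjective g A c x '' dom g) := by
  obtain ⟨u, m, L, hL, hm⟩ := hg.exists_affine_lower_bound
  refine ⟨c * (m - L * ‖x - u‖) - (c * L) ^ 2 / (2 * ν), ?_⟩
  rintro _ ⟨y, hy, rfl⟩
  have h1 := mul_le_mul_of_nonneg_left (hm y hy) hc.le
  have h2 := hA.lower (y - x)
  have h3 : ‖y - u‖ ≤ ‖y - x‖ + ‖x - u‖ := norm_sub_le_norm_sub_add_norm_sub _ _ _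
  have h4 := mul_le_mul_of_nonneg_left h3 (mul_nonneg hc.le hL)
  have h5 : c * L * ‖y - x‖ ≤ (c * L) ^ 2 / (2 * ν) + 1 / 2 * (ν * ‖y - x‖ ^ 2) := by
    rw [← sub_nonneg]
    have : (c * L) ^ 2 / (2 * ν) + 1 / 2 * (ν * ‖y - x‖ ^ 2) - c * L * ‖y - x‖ =
        (c * L - ν * ‖y - x‖) ^ 2 / (2 * ν) := by
      field_simp
      ring
    rw [this]
    positivity
  rw [proxObjective]
  linarith

/-- Strong convexity at the midpoint, by the parallelogram identity; it makes minimizing sequences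
Cauchy. -/
theorem proxObjective_midpoint (hg : IsGammaZero g) (hA : IsMetricOperator ν μ A) (hc : 0 < c)
    (x : H) {y z : H} (hy : y ∈ dom g) (hz : z ∈ dom g) :
    ∃ w ∈ dom g, proxObjective g A c x w + ν / 8 * ‖y - z‖ ^ 2 ≤
      (proxObjective g A c x y + proxObjective g A c x z) / 2 := by
  have h1 := hg.apply_le_coe hy hz (a := 1 / 2) (b := 1 / 2) (by norm_num) (by norm_num)
    (by norm_num)
  refine ⟨_, IsGammaZero.mem_dom_of_le _ h1, ?_⟩
  have h2 := mul_le_mul_of_nonneg_left (hg.toReal_le h1) hc.le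
  have h3 := hA.lower (y - z)
  have e1 : y - z = (y - x) + (-1 : ℝ) • (z - x) := by module
  have e2 : (1 / 2 : ℝ) • y + (1 / 2 : ℝ) • z - x =
      (1 / 2 : ℝ) • (y - x) + (1 / 2 : ℝ) • (z - x) := by module
  have h4 : inner ℝ (y - z) (A (y - z)) = inner ℝ (y - x) (A (y - x)) -
      2 * inner ℝ (y - x) (A (z - x)) + inner ℝ (z - x) (A (z - x)) := by
    rw [e1, hA.inner_add_self]
    simp only [map_smul, inner_smul_left, inner_smul_right, conj_trivial]
    ring
  simp only [proxObjective]
  rw [e2, hA.inner_add_self]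
  simp only [map_smul, inner_smul_left, inner_smul_right, conj_trivial]
  linarith

theorem exists_forall_proxObjective_le [CompleteSpace H] (hg : IsGammaZero g)
    (hA : IsMetricOperator ν μ A) (hν : 0 < ν) (hc : 0 < c) (x : H) :
    ∃ p ∈ dom g, ∀ y ∈ dom g, proxObjective g A c x p ≤ proxObjective g A c x y := by
  have hbdd := bddBelow_proxObjective hg hA hν hc x
  have hne := hg.dom_nonempty.image (proxObjective g A c x)
  set m := sInf (proxObjective g A c x '' dom g) with hm
  have hmle : ∀ y ∈ dom g, m ≤ proxObjective g A c x y := fun y hy => csInf_le hbdd ⟨y, hy, rfl⟩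
  have hex : ∀ n : ℕ, ∃ y ∈ dom g, proxObjective g A c x y < m + 1 / (n + 1 : ℝ) := fun n => by
    obtain ⟨_, ⟨y, hy, rfl⟩, hlt⟩ := exists_lt_of_csInf_lt hne
      (show sInf _ < m + 1 / (n + 1 : ℝ) by
        rw [← hm]
        exact lt_add_of_pos_right m Nat.one_div_pos_of_nat)
    exact ⟨y, hy, hlt⟩
  choose y hy hym using hex
  have hcauchy : CauchySeq y := by
    have hb : Tendsto (fun n : ℕ => √(8 / ν * (1 / (n + 1 : ℝ)))) atTop (𝓝 0) := by
      have := ((tendsto_one_div_add_atTop_nhds_zero_nat (𝕜 := ℝ)).const_mul (8 / ν)).sqrt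
      simpa using this
    refine cauchySeq_of_le_tendsto_0' _ (fun i j hij => ?_) hb
    obtain ⟨w, hw, hwle⟩ := proxObjective_midpoint hg hA hc x (hy i) (hy j)
    have h1 := hmle w hw
    have h2 := hym i
    have h3 := hym j
    have h4 : (1 : ℝ) / (j + 1) ≤ 1 / (i + 1) := by gcongr
    rw [dist_eq_norm]
    refine Real.le_sqrt_of_sq_le ?_
    have h5 : ν / 8 * ‖y i - y j‖ ^ 2 ≤ 1 / (i + 1 : ℝ) := by linarith
    calc ‖y i - y j‖ ^ 2 = 8 / ν * (ν / 8 * ‖y i - y j‖ ^ 2) := by field_simp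
      _ ≤ _ := by gcongr
  obtain ⟨p, hp⟩ := cauchySeq_tendsto_of_complete hcauchy
  have hq : Tendsto (fun n => 1 / 2 * inner ℝ (y n - x) (A (y n - x))) atTop
      (𝓝 (1 / 2 * inner ℝ (p - x) (A (p - x)))) :=
    ((hp.sub_const x).inner (((A.continuous.tendsto _).comp (hp.sub_const x)))).const_mul _
  have hsum : Tendsto (fun n : ℕ => 1 / (n + 1 : ℝ) -
      1 / 2 * inner ℝ (y n - x) (A (y n - x))) atTop
      (𝓝 (0 - 1 / 2 * inner ℝ (p - x) (A (p - x)))) :=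
    tendsto_one_div_add_atTop_nhds_zero_nat.sub hq
  have hgp : ∀ ε > 0,
      -- The quadratic term converges along `y`, so `g (y n)` is eventually below this bound, and
      -- lower semicontinuity passes it to `p`.
      g p ≤ ((c⁻¹ * (m + ε - 1 / 2 * inner ℝ (p - x) (A (p - x))) : ℝ) : EReal) := fun ε hε => by
    refine (hg.lsc.isClosed_preimage _).mem_of_tendsto hp ?_
    filter_upwards [hsum.eventually_lt_const (u := ε - 1 / 2 * inner ℝ (p - x) (A (p - x)))
      (by linarith)] with n hn
    change g (y n) ≤ _
    rw [← hg.coe_toReal (hy n), EReal.coe_le_coe_iff, le_inv_mul_iff₀ hc]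
    have := hym n
    rw [proxObjective] at this
    linarith
  have hpd : p ∈ dom g := IsGammaZero.mem_dom_of_le _ (hgp 1 one_pos)
  refine ⟨p, hpd, fun z hz => (le_of_forall_pos_le_add fun ε hε => ?_).trans (hmle z hz)⟩
  have := hg.toReal_le (hgp ε hε)
  rw [le_inv_mul_iff₀ hc] at this
  rw [proxObjective]
  linarith

/-- First-order optimality: compare `p` with `p + t • (y - p)`, divide by `t` and let `t ↓ 0`. -/
theorem isForwardBackwardStep_of_forall_le (hg : IsGammaZero g) (hA : IsMetricOperator ν μ A)
    (hc : 0 < c) {u w p : H} (hp : p ∈ dom g)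
    (hmin : ∀ y ∈ dom g, proxObjective g A c (u - c • w) p ≤ proxObjective g A c (u - c • w) y) :
    IsForwardBackwardStep (dom g) (fun y => (g y).toReal) A u (A w) c p := by
  refine ⟨hp, fun y hy => ?_⟩
  have key : 0 ≤ c * ((g y).toReal - (g p).toReal) + inner ℝ (y - p) (A (p - (u - c • w))) := by
    have hlim : Tendsto (fun t : ℝ => c * ((g y).toReal - (g p).toReal) +
        inner ℝ (y - p) (A (p - (u - c • w))) + t * (1 / 2 * inner ℝ (y - p) (A (y - p))))
        (𝓝[>] 0) (𝓝 (c * ((g y).toReal - (g p).toReal) +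
          inner ℝ (y - p) (A (p - (u - c • w))) + 0 * (1 / 2 * inner ℝ (y - p) (A (y - p))))) := by
      refine Tendsto.mono_left (Continuous.tendsto ?_ _) nhdsWithin_le_nhds
      fun_prop
    rw [zero_mul, add_zero] at hlim
    refine ge_of_tendsto hlim ?_
    filter_upwards [Ioo_mem_nhdsGT (one_pos : (0 : ℝ) < 1)] with t ht
    have h1 := hg.toReal_add_smul_sub_le hp hy ht
    have h2 := mul_le_mul_of_nonneg_left (hg.toReal_le h1) hc.le
    have h3 := hmin _ (IsGammaZero.mem_dom_of_le _ h1)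
    simp only [proxObjective] at h3
    have e : p + t • (y - p) - (u - c • w) = (p - (u - c • w)) + t • (y - p) := by abel
    rw [e, hA.inner_add_self] at h3
    simp only [map_smul, inner_smul_left, inner_smul_right, conj_trivial] at h3
    rw [hA.inner_comm (p - (u - c • w)) (y - p)] at h3
    refine nonneg_of_mul_nonneg_right ?_ ht.1
    linarith
  have e : inner ℝ (y - p) (A (p - (u - c • w))) =
      c * inner ℝ (y - p) (A w) - inner ℝ (y - p) (A (u - p)) := by
    have : p - (u - c • w) = c • w - (u - p) := by abel
    rw [this, map_sub, map_smul, inner_sub_right, inner_smul_right]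
  rw [e] at key
  have h1 : c⁻¹ * inner ℝ (y - p) (A (u - p)) ≤
      (g y).toReal - (g p).toReal + inner ℝ (y - p) (A w) := by
    rw [inv_mul_le_iff₀ hc]
    linarith
  linarith

theorem prox_spec [CompleteSpace H] {B : H → H → ℝ} (hB : ∀ x y, B x y = inner ℝ x (A y))
    (hg : IsGammaZero g) (hA : IsMetricOperator ν μ A) (hν : 0 < ν) (hc : 0 < c) (x : H) :
    prox B (fun y => (c : EReal) * g y) x ∈ dom g ∧ ∀ y ∈ dom g,
      proxObjective g A c x (prox B (fun y => (c : EReal) * g y) x) ≤ proxObjective g A c x y := by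
  have hsq : ∀ z, normOf B z ^ 2 = inner ℝ z (A z) := fun z => by
    rw [normOf, hB, Real.sq_sqrt (hA.nonneg hν z)]
  have hval : ∀ y ∈ dom g, (c : EReal) * g y + ((1 / 2 * normOf B (y - x) ^ 2 : ℝ) : EReal) =
      ((proxObjective g A c x y : ℝ) : EReal) := fun y hy => by
    rw [← hg.coe_toReal hy, ← EReal.coe_mul, ← EReal.coe_add, hsq, proxObjective]
  have htop : ∀ y ∉ dom g, (c : EReal) * g y + ((1 / 2 * normOf B (y - x) ^ 2 : ℝ) : EReal) = ⊤ :=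
    fun y hy => by
      have : g y = ⊤ := not_lt_top_iff.1 hy
      rw [this, EReal.coe_mul_top_of_pos hc, EReal.top_add_coe]
  obtain ⟨p, hp, hpmin⟩ := exists_forall_proxObjective_le hg hA hν hc x
  have hspec : prox B (fun y => (c : EReal) * g y) x ∈
      argminSet fun y => (c : EReal) * g y + ((1 / 2 * normOf B (y - x) ^ 2 : ℝ) : EReal) := by
    refine Classical.epsilon_spec (p := fun q => q ∈ argminSet fun y => (c : EReal) * g y +
      ((1 / 2 * normOf B (y - x) ^ 2 : ℝ) : EReal)) ⟨p, mem_argminSet_iff.2 fun y => ?_⟩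
    by_cases hy : y ∈ dom g
    · rw [hval p hp, hval y hy, EReal.coe_le_coe_iff]
      exact hpmin y hy
    · rw [htop y hy]
      exact le_top
  rw [mem_argminSet_iff] at hspec
  have hmem : prox B (fun y => (c : EReal) * g y) x ∈ dom g := by
    by_contra hcon
    have := hspec p
    rw [htop _ hcon, hval p hp, top_le_iff] at this
    exact EReal.coe_ne_top _ this
  refine ⟨hmem, fun y hy => ?_⟩
  have := hspec y
  rwa [hval _ hmem, hval y hy, EReal.coe_le_coe_iff] at this

end Prox

end VMFBS

namespace VMFBS

/-! ### From the hypotheses to an abstract run -/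

section Assembly

variable {H : Type*} [NormedAddCommGroup H] [InnerProductSpace ℝ H]

theorem normOf_scal_sq (c : InnerProductSpace.Core ℝ H) (x : H) :
    normOf (scal c) x ^ 2 = scal c x x :=
  Real.sq_sqrt (by simpa [scal] using c.re_inner_nonneg x)

/-- The operators of uniformly equivalent scalar products are bounded, self-adjoint and
uniformly elliptic. -/
theorem H3.exists_isMetricOperator [CompleteSpace H] {S : ℕ → InnerProductSpace.Core ℝ H}
    {W : ℕ → H → H} (h3 : H3 S W) :
    ∃ (A : ℕ → H →L[ℝ] H) (ν μ : ℝ), 0 < ν ∧ ν ≤ μ ∧ (∀ k x, A k x = W k x) ∧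
      ∀ k, IsMetricOperator ν μ (A k) := by
  obtain ⟨ν, μ, hν, hνμ, hb⟩ := h3.bounds
  have hcomm : ∀ k x y, inner ℝ (W k x) y = inner ℝ x (W k y) := fun k x y => by
    rw [real_inner_comm, ← h3.associated, ← h3.associated]
    simpa [scal] using (S k).conj_inner_symm x y
  let L : ℕ → H →ₗ[ℝ] H := fun k =>
    { toFun := W k
      map_add' := fun x y => ext_inner_right ℝ fun z => by
        simp only [hcomm, inner_add_left]
      map_smul' := fun r x => ext_inner_right ℝ fun z => by
        simp only [hcomm, inner_smul_left, RingHom.id_apply] }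
  -- Symmetry has already forced linearity; on a complete space it also forces continuity
  -- (Hellinger–Toeplitz).
  have hsymm : ∀ k, (L k).IsSymmetric := fun k x y => hcomm k x y
  refine ⟨fun k => ⟨L k, (hsymm k).continuous⟩, ν, μ, hν, hνμ, fun k x => rfl,
    fun k => ⟨hcomm k, fun x => ?_, fun x => ?_⟩⟩
  · have := (hb k x).1
    rwa [normOf_scal_sq, h3.associated] at this
  · have := (hb k x).2
    rwa [normOf_scal_sq, h3.associated] at this

theorem isMetricOperator_eigenvalue {A : H →L[ℝ] H} {ν μ : ℝ} (hA : IsMetricOperator ν μ A)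
    [Nontrivial H] : ν ≤ minEigenvalue A ∧ minEigenvalue A ≤ maxEigenvalue A ∧
      maxEigenvalue A ≤ μ ∧ IsMetricOperator (minEigenvalue A) (maxEigenvalue A) A := by
  have hne : Nonempty (Metric.sphere (0 : H) 1) :=
    (NormedSpace.sphere_nonempty.2 zero_le_one).to_subtype
  have hlow : ∀ x : Metric.sphere (0 : H) 1, ν ≤ inner ℝ (x : H) (A x) := fun x => by
    have := hA.lower x
    rwa [norm_eq_of_mem_sphere, one_pow, mul_one] at this
  have hupp : ∀ x : Metric.sphere (0 : H) 1, inner ℝ (x : H) (A x) ≤ μ := fun x => by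
    have := hA.upper x
    rwa [norm_eq_of_mem_sphere, one_pow, mul_one] at this
  have hbb : BddBelow (range fun x : Metric.sphere (0 : H) 1 => inner ℝ (x : H) (A x)) :=
    ⟨ν, by rintro _ ⟨x, rfl⟩; exact hlow x⟩
  have hba : BddAbove (range fun x : Metric.sphere (0 : H) 1 => inner ℝ (x : H) (A x)) :=
    ⟨μ, by rintro _ ⟨x, rfl⟩; exact hupp x⟩
  have hnormalize : ∀ x : H, x ≠ 0 → ∃ u : Metric.sphere (0 : H) 1,
      inner ℝ x (A x) = inner ℝ (u : H) (A u) * ‖x‖ ^ 2 := fun x hx => by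
    have hx0 : ‖x‖ ≠ 0 := norm_ne_zero_iff.2 hx
    refine ⟨⟨‖x‖⁻¹ • x, by simp [norm_smul, hx0]⟩, ?_⟩
    simp only [map_smul, inner_smul_left, inner_smul_right, conj_trivial]
    field_simp
  refine ⟨le_ciInf hlow, (ciInf_le hbb hne.some).trans (le_ciSup hba hne.some), ciSup_le hupp,
    hA.symm, fun x => ?_, fun x => ?_⟩
  · by_cases hx : x = 0
    · simp [hx]
    · obtain ⟨u, hu⟩ := hnormalize x hx
      rw [hu]
      exact mul_le_mul_of_nonneg_right (ciInf_le hbb u) (sq_nonneg _)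
  · by_cases hx : x = 0
    · simp [hx]
    · obtain ⟨u, hu⟩ := hnormalize x hx
      rw [hu]
      exact mul_le_mul_of_nonneg_right (le_ciSup hba u) (sq_nonneg _)

theorem exists_isMonotoneRescaling {S : ℕ → InnerProductSpace.Core ℝ H} {W : ℕ → H → H}
    (h3 : H3 S W) (h45 : H4 S ∨ H5 W) {A : ℕ → H →L[ℝ] H} {ν μ : ℝ} (hν : 0 < ν) (hνμ : ν ≤ μ)
    (hAW : ∀ k x, A k x = W k x) (hA : ∀ k, IsMetricOperator ν μ (A k)) :
    ∃ (V : ℕ → H →L[ℝ] H) (d : ℕ → ℝ) (κ' d₀ d₁ : ℝ),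
      IsMonotoneRescaling A V d κ' d₀ d₁ := by
  rcases h45 with ⟨η, hη0, hη, hle⟩ | h5
  · refine exists_isMonotoneRescaling_of_le hA hν hη0 hη fun k x => ?_
    have := hle k x
    rwa [normOf_scal_sq, normOf_scal_sq, h3.associated, h3.associated, ← hAW, ← hAW] at this
  -- In the trivial space the unit sphere is empty and the spectral bounds carry no information.
  · rcases subsingleton_or_nontrivial H with hsub | hnt
    · refine exists_isMonotoneRescaling_of_le hA hν (η := fun _ => 0) (fun _ => le_rfl)
        summable_zero fun k x => ?_
      simp [Subsingleton.elim x 0]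
    · have h5' : Summable fun k => maxEigenvalue (A k) - minEigenvalue (A k) := by
        refine h5.congr fun k => ?_
        rw [show W k = A k from funext fun x => (hAW k x).symm]
      exact exists_isMonotoneRescaling_of_summable hν (hν.trans_le hνμ)
        (fun k => (isMetricOperator_eigenvalue (hA k)).1)
        (fun k => (isMetricOperator_eigenvalue (hA k)).2.1)
        (fun k => (isMetricOperator_eigenvalue (hA k)).2.2.1)
        (fun k => (isMetricOperator_eigenvalue (hA k)).2.2.2) h5'

variable {f g : H → EReal}

/-- A norm-convergent sequence together with its limit is compact, hence weakly compact, so the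
uniform continuity assumption applies to it. -/
theorem H2.continuousOn_grad (h2 : H2 f g) : ContinuousOn (grad (inner ℝ) f) (dom g) := by
  intro a ha
  refine tendsto_of_seq_tendsto fun u hu => ?_
  obtain ⟨hua, hud⟩ := tendsto_nhdsWithin_iff.1 hu
  obtain ⟨N, hN⟩ := eventually_atTop.1 hud
  set w : ℕ → H := fun n => u (n + N) with hw
  have hwa : Tendsto w atTop (𝓝 a) := (tendsto_add_atTop_iff_nat N).2 hua
  have hK : IsCompact (insert a (range w)) := hwa.isCompact_insert_range
  have hsub : insert a (range w) ⊆ dom g := by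
    rintro _ (rfl | ⟨n, rfl⟩)
    · exact ha
    · exact hN _ (Nat.le_add_left N n)
  have hunif := h2.uniformContinuousOn _ hsub (hK.image (toWeakSpaceCLM ℝ H).continuous)
  have hlim : Tendsto (fun n => grad (inner ℝ) f (w n)) atTop (𝓝 (grad (inner ℝ) f a)) :=
    (hunif.continuousOn a (mem_insert _ _)).tendsto.comp (tendsto_nhdsWithin_iff.2
      ⟨hwa, Eventually.of_forall fun n => mem_insert_of_mem _ ⟨n, rfl⟩⟩)
  exact (tendsto_add_atTop_iff_nat N).1 hlim

theorem H2.hasGateauxGradient (h2 : H2 f g) {x : H} (hx : x ∈ dom g) :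
    HasGateauxGradient (inner ℝ) f x (grad (inner ℝ) f x) :=
  hasGateauxGradient_grad (h2.differentiable x hx).choose_spec

/-- Both sides represent the same directional derivatives. Surjectivity of `A` guarantees that a
gradient in the metric `B` exists, so the choice in `grad` is meaningful. -/
theorem apply_grad_eq [CompleteSpace H] {B : H → H → ℝ} {A : H →L[ℝ] H} {ν μ : ℝ}
    (hB : ∀ x y, B x y = inner ℝ x (A y)) (hA : IsMetricOperator ν μ A) (hν : 0 < ν) (h2 : H2 f g)
    {x : H} (hx : x ∈ dom g) : A (grad B f x) = grad (inner ℝ) f x := by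
  have hg := h2.hasGateauxGradient hx
  obtain ⟨u, hu⟩ := hA.surjective hν (grad (inner ℝ) f x)
  have hB' : HasGateauxGradient B f x u := ⟨hg.1, fun d => by
    rw [hB, hu]
    exact hg.2 d⟩
  refine ext_inner_left ℝ fun d => ?_
  rw [← hB]
  exact (hasGateauxGradient_grad hB').apply_eq hg d

theorem H1.coe_toReal_add (h1 : H1 f g) {x : H} (hx : x ∈ dom g) :
    (((f x).toReal + (g x).toReal : ℝ) : EReal) = (f + g) x := by
  rw [EReal.coe_add, h1.f_mem.coe_toReal (h1.dom_subset hx), h1.g_mem.coe_toReal hx, Pi.add_apply]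

theorem H1.add_eq_top (h1 : H1 f g) {x : H} (hx : x ∉ dom g) : (f + g) x = ⊤ := by
  have hx' : g x = ⊤ := not_lt_top_iff.1 hx
  rw [Pi.add_apply, hx', EReal.add_top_of_ne_bot (h1.f_mem.ne_bot x)]

theorem H1.setOf_toReal_le (h1 : H1 f g) (a : ℝ) :
    {u ∈ dom g | (f u).toReal + (g u).toReal ≤ a} = {u | (f + g) u ≤ (a : EReal)} := by
  ext u
  by_cases hu : u ∈ dom g
  · simp only [mem_ofPred_eq, hu, true_and]
    rw [← h1.coe_toReal_add hu, EReal.coe_le_coe_iff]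
  · simp [hu, h1.add_eq_top hu, -Pi.add_apply]

theorem H1.isClosed_sublevel (h1 : H1 f g) (a : ℝ) :
    IsClosed {u ∈ dom g | (f u).toReal + (g u).toReal ≤ a} := by
  rw [h1.setOf_toReal_le]
  exact (h1.f_mem.lsc.add' h1.g_mem.lsc fun x => EReal.continuousAt_add
    (Or.inr (h1.g_mem.ne_bot x)) (Or.inl (h1.f_mem.ne_bot x))).isClosed_preimage _

theorem H1.convex_sublevel (h1 : H1 f g) (a : ℝ) :
    Convex ℝ {u ∈ dom g | (f u).toReal + (g u).toReal ≤ a} := by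
  refine convex_iff_forall_pos.2 fun u hu v hv s t hs ht hst => ?_
  have hg := h1.g_mem.apply_le_coe hu.1 hv.1 hs ht hst
  have hf := h1.f_mem.apply_le_coe (h1.dom_subset hu.1) (h1.dom_subset hv.1) hs ht hst
  refine ⟨IsGammaZero.mem_dom_of_le _ hg, ?_⟩
  have h2 := h1.g_mem.toReal_le hg
  have h3 := h1.f_mem.toReal_le hf
  have h4 := mul_le_mul_of_nonneg_left hu.2 hs.le
  have h5 := mul_le_mul_of_nonneg_left hv.2 ht.le
  have h6 : s * a + t * a = a := by rw [← add_mul, hst, one_mul]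
  linarith

theorem H1.mem_argminSet_iff (h1 : H1 f g) {a : H} :
    a ∈ argminSet (f + g) ↔ a ∈ dom g ∧ ∀ y ∈ dom g,
      (f a).toReal + (g a).toReal ≤ (f y).toReal + (g y).toReal := by
  rw [VMFBS.mem_argminSet_iff]
  constructor
  · intro h
    have ha : a ∈ dom g := by
      by_contra hcon
      obtain ⟨y, hy⟩ := h1.g_mem.dom_nonempty
      have := h y
      rw [h1.add_eq_top hcon, ← h1.coe_toReal_add hy, top_le_iff] at this
      exact EReal.coe_ne_top _ this
    refine ⟨ha, fun y hy => ?_⟩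
    have := h y
    rwa [← h1.coe_toReal_add ha, ← h1.coe_toReal_add hy, EReal.coe_le_coe_iff] at this
  · rintro ⟨ha, h⟩ y
    by_cases hy : y ∈ dom g
    · rw [← h1.coe_toReal_add ha, ← h1.coe_toReal_add hy, EReal.coe_le_coe_iff]
      exact h y hy
    · rw [h1.add_eq_top hy]
      exact le_top

theorem isForwardBackwardStep_prox [CompleteSpace H] {B : H → H → ℝ} {A : H →L[ℝ] H} {ν μ c : ℝ}
    (hB : ∀ x y, B x y = inner ℝ x (A y)) (hA : IsMetricOperator ν μ A) (hν : 0 < ν) (h1 : H1 f g)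
    (h2 : H2 f g) (hc : 0 < c) {x : H} (hx : x ∈ dom g) :
    IsForwardBackwardStep (dom g) (fun y => (g y).toReal) A x (grad (inner ℝ) f x) c
      (prox B (fun y => (c : EReal) * g y) (x - c • grad B f x)) := by
  obtain ⟨hp, hmin⟩ := prox_spec hB h1.g_mem hA hν hc (x - c • grad B f x)
  rw [← apply_grad_eq hB hA hν h2 hx]
  exact isForwardBackwardStep_of_forall_le h1.g_mem hA hc hp hmin

/-- The linear growth test of a line search, for the full step. -/
theorem le_of_LS3_test [CompleteSpace H] {B : H → H → ℝ} {A : H →L[ℝ] H} {ν μ δ c : ℝ}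
    (hB : ∀ x y, B x y = inner ℝ x (A y)) (hA : IsMetricOperator ν μ A) (hν : 0 < ν) (h1 : H1 f g)
    (h2 : H2 f g) {x z : H} (hx : x ∈ dom g) (hz : z ∈ dom g)
    (h : normOf B (grad B f z - grad B f x) ≤ δ / c * normOf B (z - x)) :
    (f z).toReal ≤ (f x).toReal + inner ℝ (z - x) (grad (inner ℝ) f x) +
      δ / c * inner ℝ (z - x) (A (z - x)) := by
  have h3 := h1.f_mem.gradient_inequality (h2.hasGateauxGradient hz) (h1.dom_subset hx)
  have h4 := hA.inner_le hν (z - x) (grad B f z - grad B f x)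
  rw [map_sub, apply_grad_eq hB hA hν h2 hx, apply_grad_eq hB hA hν h2 hz] at h4
  rw [normOf, normOf, hB, hB, map_sub, apply_grad_eq hB hA hν h2 hx,
    apply_grad_eq hB hA hν h2 hz] at h
  have h5 := mul_le_mul_of_nonneg_left h (Real.sqrt_nonneg (inner ℝ (z - x) (A (z - x))))
  have h6 := Real.mul_self_sqrt (hA.nonneg hν (z - x))
  rw [mul_left_comm, h6] at h5
  have h7 : inner ℝ (x - z) (grad (inner ℝ) f z) = -inner ℝ (z - x) (grad (inner ℝ) f z) := by
    rw [← inner_neg_left, neg_sub]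
  rw [inner_sub_right] at h4
  linarith

/-- With `w` the difference of the `B`-gradients, `A w` is the difference of the ambient ones, and
ellipticity bounds the `B`-norm of `w` by `‖A w‖ / √ν`. -/
theorem displacement_le_of_not_LS3_test [CompleteSpace H] {B : H → H → ℝ} {A : H →L[ℝ] H}
    {ν μ δ c : ℝ} (hB : ∀ x y, B x y = inner ℝ x (A y)) (hA : IsMetricOperator ν μ A) (hν : 0 < ν)
    (h2 : H2 f g) (hδ : 0 < δ) {x z : H} (hx : x ∈ dom g) (hz : z ∈ dom g)
    (h : ¬normOf B (grad B f z - grad B f x) ≤ δ / c * normOf B (z - x)) :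
    √(inner ℝ (x - z) (A (x - z))) / c ≤
      (δ * √ν)⁻¹ * ‖grad (inner ℝ) f z - grad (inner ℝ) f x‖ := by
  have hνs : 0 < √ν := Real.sqrt_pos.2 hν
  rw [not_le, normOf, normOf, hB, hB] at h
  rw [IsMetricOperator.inner_sub_self_comm, mul_inv, mul_assoc, le_inv_mul_iff₀ hδ,
    le_inv_mul_iff₀ hνs]
  have h3 : √ν * √(inner ℝ (grad B f z - grad B f x) (A (grad B f z - grad B f x))) ≤
      ‖grad (inner ℝ) f z - grad (inner ℝ) f x‖ := by
    set w := grad B f z - grad B f x with hw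
    have hAw : A w = grad (inner ℝ) f z - grad (inner ℝ) f x := by
      rw [hw, map_sub, apply_grad_eq hB hA hν h2 hx, apply_grad_eq hB hA hν h2 hz]
    rw [← hAw]
    have h4 := hA.sqrt_lower hν w
    have h5 := Real.mul_self_sqrt (hA.nonneg hν w)
    have h6 := real_inner_le_norm w (A w)
    rcases (Real.sqrt_nonneg (inner ℝ w (A w))).eq_or_lt with h0 | h0
    · rw [← h0, mul_zero]
      exact norm_nonneg _
    · refine le_of_mul_le_mul_right ?_ h0
      rw [mul_assoc, h5]
      calc √ν * inner ℝ w (A w) ≤ √ν * (‖w‖ * ‖A w‖) := by gcongr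
        _ = √ν * ‖w‖ * ‖A w‖ := by ring
        _ ≤ √(inner ℝ w (A w)) * ‖A w‖ := by gcongr
        _ = _ := mul_comm _ _
  refine le_trans ?_ h3
  rw [mul_div_assoc', ← div_mul_eq_mul_div]
  exact mul_le_mul_of_nonneg_left h.le hνs.le

theorem LS1_test_iff (h1 : H1 f g) {B : H → H → ℝ} {A : H →L[ℝ] H} {ν μ r : ℝ}
    (hB : ∀ x y, B x y = inner ℝ x (A y)) (hA : IsMetricOperator ν μ A) (hν : 0 < ν)
    {x z v : H} (hx : x ∈ dom g) (hz : z ∈ dom g) :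
    f z - f x - ((inner ℝ (z - x) v : ℝ) : EReal) ≤ ((r * normOf B (z - x) ^ 2 : ℝ) : EReal) ↔
      (f z).toReal ≤ (f x).toReal + inner ℝ (z - x) v + r * inner ℝ (z - x) (A (z - x)) := by
  rw [normOf, hB, Real.sq_sqrt (hA.nonneg hν _), ← h1.f_mem.coe_toReal (h1.dom_subset hx),
    ← h1.f_mem.coe_toReal (h1.dom_subset hz), ← EReal.coe_sub, ← EReal.coe_sub,
    EReal.coe_le_coe_iff, EReal.toReal_coe, EReal.toReal_coe]
  constructor <;> intro h <;> linarith

/-- The gradient inequality at `z` turns the failed test into a quadratic bound by `‖z - x‖` times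
the gradient difference; ellipticity then cancels one factor. The constant agrees with that for LS3,
so both rules feed the same abstract run. -/
theorem displacement_le_of_not_LS1_test (h1 : H1 f g) {A : H →L[ℝ] H} {ν μ δ c : ℝ}
    (hA : IsMetricOperator ν μ A) (hν : 0 < ν) (h2 : H2 f g) (hδ : 0 < δ)
    {x z : H} (hx : x ∈ dom g) (hz : z ∈ dom g)
    (h : ¬(f z).toReal ≤ (f x).toReal + inner ℝ (z - x) (grad (inner ℝ) f x) +
      δ / c * inner ℝ (z - x) (A (z - x))) :
    √(inner ℝ (x - z) (A (x - z))) / c ≤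
      (δ * √ν)⁻¹ * ‖grad (inner ℝ) f z - grad (inner ℝ) f x‖ := by
  have hνs : 0 < √ν := Real.sqrt_pos.2 hν
  rw [IsMetricOperator.inner_sub_self_comm]
  have h3 := h1.f_mem.gradient_inequality (h2.hasGateauxGradient hz) (h1.dom_subset hx)
  have h4 := real_inner_le_norm (z - x) (grad (inner ℝ) f z - grad (inner ℝ) f x)
  have h5 : inner ℝ (x - z) (grad (inner ℝ) f z) = -inner ℝ (z - x) (grad (inner ℝ) f z) := by
    rw [← inner_neg_left, neg_sub]
  have h6 := Real.mul_self_sqrt (hA.nonneg hν (z - x))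
  have h7 := hA.sqrt_lower hν (z - x)
  rw [inner_sub_right] at h4
  rw [not_le, ← h6] at h
  set s := √(inner ℝ (z - x) (A (z - x)))
  set n := ‖grad (inner ℝ) f z - grad (inner ℝ) f x‖
  have hn : 0 ≤ n := norm_nonneg _
  have h8 : δ / c * (s * s) ≤ ‖z - x‖ * n := by linarith
  have hs : 0 ≤ s := Real.sqrt_nonneg _
  rw [le_inv_mul_iff₀ (by positivity)]
  rcases hs.eq_or_lt with h0 | h0
  · rw [← h0]
    simpa using hn
  · refine le_of_mul_le_mul_right ?_ h0
    calc δ * √ν * (s / c) * s = √ν * (δ / c * (s * s)) := by ring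
      _ ≤ √ν * (‖z - x‖ * n) := by gcongr
      _ = √ν * ‖z - x‖ * n := by ring
      _ ≤ s * n := by gcongr
      _ = n * s := mul_comm _ _

/-- Stepsizes produced by backtracking along `γbar * θ ^ i` for a test `T`. -/
theorem backtracking_spec {T : ℝ → Prop} {θ γbar c : ℝ} (hθ : θ ∈ Ioo (0 : ℝ) 1)
    (hγbar : 0 < γbar)
    (h : IsGreatest {c : ℝ | 0 < c ∧ (∃ i : ℕ, c = γbar * θ ^ i) ∧ T c} c) :
    c ≤ γbar ∧ T c ∧ (c = γbar ∨ ¬T (c / θ)) := by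
  obtain ⟨⟨hc, ⟨i, hi⟩, hT⟩, hub⟩ := h
  refine ⟨?_, hT, ?_⟩
  · rw [hi]
    exact mul_le_of_le_one_right hγbar.le (pow_le_one₀ hθ.1.le hθ.2.le)
  · cases i with
    | zero => left; simpa using hi
    | succ i =>
      right
      intro hcon
      have hdiv : c / θ = γbar * θ ^ i := by
        rw [hi, pow_succ]
        have := hθ.1.ne'
        field_simp
      have h1 := hub ⟨div_pos hc hθ.1, ⟨i, hdiv⟩, hcon⟩
      have h2 : c < c / θ := by
        rw [lt_div_iff₀ hθ.1]
        exact mul_lt_of_lt_one_right hc hθ.2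
      linarith

theorem fbStep_one (B : H → H → ℝ) (f g : H → EReal) (x : H) (c : ℝ) :
    fbStep B f g x c 1 = prox B (fun y => (c : EReal) * g y) (x - c • grad B f x) := by
  rw [fbStep, one_smul, add_sub_cancel]

theorem isForwardBackwardRun [CompleteSpace H] {S : ℕ → InnerProductSpace.Core ℝ H}
    {W : ℕ → H → H} (h1 : H1 f g) (h2 : H2 f g) (h3 : H3 S W) {A : ℕ → H →L[ℝ] H} {ν μ : ℝ}
    (hν : 0 < ν) (hνμ : ν ≤ μ) (hAW : ∀ k x, A k x = W k x)
    (hA : ∀ k, IsMetricOperator ν μ (A k)) {γ lam : ℕ → ℝ} {x y : ℕ → H}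
    (hxy : IsVMFBS S f g γ lam x y) (hlam : ∀ k, lam k = 1) {δ θ γbar : ℝ}
    (hδ : δ ∈ Ioo (0 : ℝ) 1) (hθ : θ ∈ Ioo (0 : ℝ) 1) (hγbar : 0 < γbar)
    (hLS : LS1 S f g δ θ γbar γ lam x ∨ LS3 S f g δ θ γbar γ lam x) :
    IsForwardBackwardRun (dom g) (fun u => (f u).toReal) (fun u => (g u).toReal)
      (grad (inner ℝ) f) A ν μ δ θ γbar (δ * √ν)⁻¹ γ x := by
  have hB : ∀ k u v, scal (S k) u v = inner ℝ u (A k v) := fun k u v => by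
    rw [h3.associated, hAW]
  have hnext : ∀ k, x (k + 1) = fbStep (scal (S k)) f g (x k) (γ k) (lam k) := fun k => by
    rw [hxy.relax, hxy.backward, fbStep]
  have hstep : ∀ k, x k ∈ dom g → ∀ c, 0 < c → IsForwardBackwardStep (dom g)
      (fun u => (g u).toReal) (A k) (x k) (grad (inner ℝ) f (x k)) c
      (fbStep (scal (S k)) f g (x k) c (lam k)) := fun k hk c hc => by
    rw [hlam, fbStep_one]
    exact isForwardBackwardStep_prox (hB k) (hA k) hν h1 h2 hc hk
  -- Membership comes first: gradients and step inequalities are available only on `dom g`.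
  have hmem : ∀ k, x k ∈ dom g := fun k => by
    induction k with
    | zero => exact hxy.init
    | succ k ih =>
      rw [hnext]
      exact (hstep k ih _ (hxy.stepsize_pos k)).mem
  have hsearch : ∀ k, γ k ≤ γbar ∧
      (f (x (k + 1))).toReal ≤ (f (x k)).toReal +
        inner ℝ (x (k + 1) - x k) (grad (inner ℝ) f (x k)) +
        δ / γ k * inner ℝ (x k - x (k + 1)) (A k (x k - x (k + 1))) ∧
      (γ k = γbar ∨ √(inner ℝ (x k - fbStep (scal (S k)) f g (x k) (γ k / θ) (lam k))
          (A k (x k - fbStep (scal (S k)) f g (x k) (γ k / θ) (lam k)))) / (γ k / θ) ≤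
        (δ * √ν)⁻¹ * ‖grad (inner ℝ) f (fbStep (scal (S k)) f g (x k) (γ k / θ) (lam k)) -
          grad (inner ℝ) f (x k)‖) := fun k => by
    have hγ := hxy.stepsize_pos k
    have hγθ : 0 < γ k / θ := div_pos hγ hθ.1
    have hm1 := hmem (k + 1)
    have hm2 := (hstep k (hmem k) _ hγθ).mem
    rw [IsMetricOperator.inner_sub_self_comm]
    rcases hLS with hLS | hLS
    · obtain ⟨ha, hb, hc⟩ := backtracking_spec hθ hγbar (hLS.stepsize k)
      refine ⟨ha, ?_, hc.imp_right fun hc => ?_⟩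
      · rw [← hnext, LS1_test_iff h1 (hB k) (hA k) hν (hmem k) hm1, hlam, mul_one] at hb
        exact hb
      · rw [LS1_test_iff h1 (hB k) (hA k) hν (hmem k) hm2] at hc
        refine displacement_le_of_not_LS1_test h1 (hA k) hν h2 hδ.1 (hmem k) hm2 ?_
        simpa only [hlam, mul_one] using hc
    · obtain ⟨ha, hb, hc⟩ := backtracking_spec hθ hγbar (hLS.stepsize k)
      refine ⟨ha, ?_, hc.imp_right fun hc => ?_⟩
      · rw [← hnext] at hb
        refine le_of_LS3_test (hB k) (hA k) hν h1 h2 (hmem k) hm1 ?_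
        simpa only [hlam, mul_one] using hb
      · refine displacement_le_of_not_LS3_test (hB k) (hA k) hν h2 hδ.1 (hmem k) hm2 ?_
        simpa only [hlam, mul_one] using hc
  exact
    { ν_pos := hν
      μ_nonneg := hν.le.trans hνμ
      metric := hA
      gradient := fun u hu v hv =>
        h1.f_mem.gradient_inequality (h2.hasGateauxGradient hu) (h1.dom_subset hv)
      continuousOn := h2.continuousOn_grad
      convex := h1.convex_sublevel
      isClosed := h1.isClosed_sublevel
      δ_lt := hδ.2
      θ_mem := hθ
      init := hxy.init
      γ_pos := hxy.stepsize_pos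
      γ_le := fun k => (hsearch k).1
      step := fun k => by
        rw [hnext]
        exact hstep k (hmem k) _ (hxy.stepsize_pos k)
      decrease := fun k => (hsearch k).2.1
      backtrack := fun k => (hsearch k).2.2.imp_right fun h =>
        ⟨_, hstep k (hmem k) _ (div_pos (hxy.stepsize_pos k) hθ.1), h⟩ }

end Assembly

end VMFBS

/-! ### The convergence theorem -/

theorem mainTheorem5 {H : Type*} [NormedAddCommGroup H] [InnerProductSpace ℝ H] [CompleteSpace H]
    (f g : H → EReal) (S : ℕ → InnerProductSpace.Core ℝ H) (W : ℕ → H → H)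
    (h1 : H1 f g) (h2 : H2 f g) (h3 : H3 S W) (h45 : H4 S ∨ H5 W)
    (γ lam : ℕ → ℝ) (x y : ℕ → H) (hxy : IsVMFBS S f g γ lam x y)
    (hlam : ∀ k, lam k = 1)
    (δ θ γbar : ℝ) (hδ : δ ∈ Ioo (0 : ℝ) 1) (hθ : θ ∈ Ioo (0 : ℝ) 1) (hγbar : 0 < γbar)
    (hLS : LS1 S f g δ θ γbar γ lam x ∨ LS3 S f g δ θ γbar γ lam x) :
    (Antitone (fun k => (f + g) (x k)) ∧
      Tendsto (fun k => (f + g) (x k)) atTop (𝓝 (⨅ z, (f + g) z))) ∧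
    (⊥ < ⨅ z, (f + g) z → Summable fun k => ‖x (k + 1) - x k‖ ^ 2) ∧
    ((argminSet (f + g)).Nonempty →
      (∃ xbar ∈ argminSet (f + g),
        Tendsto (fun k => toWeakSpace ℝ H (x k)) atTop (𝓝 (toWeakSpace ℝ H xbar))) ∧
      (0 < ⨅ k, γ k →
        (fun k => ((f + g) (x k) - ⨅ z, (f + g) z).toReal) =o[atTop] fun k : ℕ => 1 / (k : ℝ))) ∧
    (argminSet (f + g) = ∅ → Tendsto (fun k => ‖x k‖) atTop atTop) := by
  obtain ⟨A, ν, μ, hν, hνμ, hAW, hA⟩ := h3.exists_isMetricOperator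
  obtain ⟨V, c, κ, c₀, c₁, hV⟩ := exists_isMonotoneRescaling h3 h45 hν hνμ hAW hA
  have hrun := isForwardBackwardRun h1 h2 h3 hν hνμ hAW hA hxy hlam hδ hθ hγbar hLS
  have hanti : Antitone (fun k => (f + g) (x k)) := fun i j hij => by
    dsimp only
    rw [← h1.coe_toReal_add (hrun.mem i), ← h1.coe_toReal_add (hrun.mem j), EReal.coe_le_coe_iff]
    exact hrun.antitone hij
  refine ⟨⟨hanti, ?_⟩, fun hbot => ?_, fun ⟨a, ha⟩ => ⟨?_, fun hγ => ?_⟩, fun hempty => ?_⟩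
  · have heq : ⨅ z, (f + g) z = ⨅ k, (f + g) (x k) := by
      refine le_antisymm (le_iInf fun k => iInf_le _ _) (le_iInf fun z => ?_)
      by_cases hz : z ∈ dom g
      -- Comparison with every real `r > (f + g) z` also covers an infimum equal to `⊥`.
      · rw [← EReal.le_of_forall_lt_iff_le]
        intro r hr
        rw [← h1.coe_toReal_add hz, EReal.coe_lt_coe_iff] at hr
        obtain ⟨k, hk⟩ := hrun.exists_value_lt hV hz (sub_pos.2 hr)
        rw [add_sub_cancel] at hk
        refine (iInf_le _ k).trans ?_
        rw [← h1.coe_toReal_add (hrun.mem k), EReal.coe_le_coe_iff]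
        exact hk.le
      · rw [h1.add_eq_top hz]
        exact le_top
    rw [heq]
    exact tendsto_atTop_iInf hanti
  · obtain ⟨m, -, hm⟩ := EReal.lt_iff_exists_real_btwn.1 hbot
    refine hrun.summable_norm_sq (m := m) fun k => ?_
    rw [← EReal.coe_le_coe_iff, h1.coe_toReal_add (hrun.mem k)]
    exact hm.le.trans (iInf_le _ _)
  · obtain ⟨had, hamin⟩ := h1.mem_argminSet_iff.1 ha
    obtain ⟨b, hb, hbmin, hlim⟩ := hrun.tendsto_inner hV had hamin
    exact ⟨b, h1.mem_argminSet_iff.2 ⟨hb, hbmin⟩, tendsto_toWeakSpace_of_tendsto_inner hlim⟩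
  · obtain ⟨had, hamin⟩ := h1.mem_argminSet_iff.1 ha
    have hbdd : BddBelow (range γ) :=
      ⟨0, by rintro _ ⟨k, rfl⟩; exact (hxy.stepsize_pos k).le⟩
    refine (hrun.isLittleO hV had hamin hγ fun k => ciInf_le hbdd k).congr_left fun k => ?_
    have ha' : (f + g) a = ⨅ z, (f + g) z := ha
    rw [← ha', ← h1.coe_toReal_add had, ← h1.coe_toReal_add (hrun.mem k), ← EReal.coe_sub,
      EReal.toReal_coe]
  · refine hrun.tendsto_norm_atTop hV ?_
    rintro ⟨a, had, hamin⟩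
    have : a ∈ argminSet (f + g) := h1.mem_argminSet_iff.2 ⟨had, hamin⟩
    rw [hempty] at this
    exact this
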